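/- An instance of the weighted unit-height 4M-labeling problem consists of a finite set $P$ of points in $\mathbb{R}^2$ and, for each $p\in P$, a label length $l(p)>0$, a weight $w(p)\ge 0$, and a finite set $A(p)$ of anchor points on the boundary of the rectangle $[0,l(p)]\times[0,1]$. A labeling is a pair $(Q,z)$ with $Q\subseteq P$ and $z:Q\to\mathbb{R}^2$ such that for every $p\in Q$ there is an $a\in A(p)$ with $z(p)+a=p$, and such that the open labels $z(p)+(0,l(p))\times(0,1)$, $p\in Q$, are pairwise disjoint. Its weight is $\sum_{p\in Q}w(p)$. Let $n=|P|+\sum_{p\in P}|A(p)|$ be the size of the instance. Running times refer to the unit-cost real RAM (exact arithmetic operations $+,-,\cdot,/$ and comparisons on real numbers; counters and array indices in $\mathbb{N}$ with addition, truncated subtraction and comparison; no rounding). The problem has a polynomial-time approximation scheme: there is a single algorithm that takes an instance and a real number $\varepsilon>0$ as input, outputs a labeling whose weight is at least $(1-\varepsilon)$ times the maximum weight of a labeling, and for each fixed $\varepsilon>0$ runs in time polynomial in $n$. Moreover, its running time is $n^{O(1/\varepsilon)}$ for $0<\varepsilon\le 1$; that is, there is an absolute constant $C$ such that for all $\varepsilon$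 with $0<\varepsilon\le 1$ and all instances of size $n$ the algorithm makes at most $\max(2,n)^{C/\varepsilon}$ steps. -/

import Mathlib

/-! ## The real RAM

A program works on finitely many unbounded arrays of natural numbers and finitely many unbounded
arrays of exact real numbers.  Natural numbers serve as counters and as array indices; on them only
addition, truncated subtraction and comparison are available.  On reals there are the four
arithmetic operations and exact comparison; there is no rounding and no conversion of a real into
a natural number.  The only literals are natural numbers.  Every operation has unit cost. -/

namespace RealRAM

/-- The memory: `s.nat k i` and `s.real k i` are the entries at index `i` of the `k`-th array of
natural numbers and of the `k`-th array of reals. -/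
structure State where
  nat : ℕ → ℕ → ℕ
  real : ℕ → ℕ → ℝ

def State.setNat (s : State) (k i v : ℕ) : State :=
  { s with nat := Function.update s.nat k (Function.update (s.nat k) i v) }

noncomputable def State.setReal (s : State) (k i : ℕ) (v : ℝ) : State :=
  { s with real := Function.update s.real k (Function.update (s.real k) i v) }

/-- Expressions with natural values; `read k e` is the entry at index `e` of the `k`-th array. -/
inductive NExpr where
  | lit (c : ℕ)
  | read (k : ℕ) (e : NExpr)
  | add (a b : NExpr)
  | sub (a b : NExpr)

def NExpr.eval (s : State) : NExpr → ℕ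
  | .lit c => c
  | .read k e => s.nat k (e.eval s)
  | .add a b => a.eval s + b.eval s
  | .sub a b => a.eval s - b.eval s

def NExpr.cost : NExpr → ℕ
  | .lit _ => 1
  | .read _ e => e.cost + 1
  | .add a b => a.cost + b.cost + 1
  | .sub a b => a.cost + b.cost + 1

/-- Expressions with real values (division by zero returns zero). -/
inductive RExpr where
  | lit (c : ℕ)
  | read (k : ℕ) (e : NExpr)
  | add (a b : RExpr)
  | sub (a b : RExpr)
  | mul (a b : RExpr)
  | div (a b : RExpr)

noncomputable def RExpr.eval (s : State) : RExpr → ℝ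
  | .lit c => c
  | .read k e => s.real k (e.eval s)
  | .add a b => a.eval s + b.eval s
  | .sub a b => a.eval s - b.eval s
  | .mul a b => a.eval s * b.eval s
  | .div a b => a.eval s / b.eval s

def RExpr.cost : RExpr → ℕ
  | .lit _ => 1
  | .read _ e => e.cost + 1
  | .add a b => a.cost + b.cost + 1
  | .sub a b => a.cost + b.cost + 1
  | .mul a b => a.cost + b.cost + 1
  | .div a b => a.cost + b.cost + 1

/-- Conditions for branching. -/
inductive Test where
  | natLe (a b : NExpr)
  | realLe (a b : RExpr)
  | neg (t : Test)
  | and (t u : Test)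

def Test.holds (s : State) : Test → Prop
  | .natLe a b => a.eval s ≤ b.eval s
  | .realLe a b => a.eval s ≤ b.eval s
  | .neg t => ¬ t.holds s
  | .and t u => t.holds s ∧ u.holds s

def Test.cost : Test → ℕ
  | .natLe a b => a.cost + b.cost + 1
  | .realLe a b => a.cost + b.cost + 1
  | .neg t => t.cost + 1
  | .and t u => t.cost + u.cost + 1

/-- Programs: assignments to array entries, sequencing, branching and while loops. -/
inductive Program where
  | nop
  | assignNat (k : ℕ) (i e : NExpr)
  | assignReal (k : ℕ) (i : NExpr) (e : RExpr)
  | seq (p q : Program)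
  | branch (t : Test) (p q : Program)
  | loop (t : Test) (p : Program)

/-- `Exec p s T s'`: started in memory state `s`, the program `p` halts after exactly `T` steps in
memory state `s'`. -/
inductive Exec : Program → State → ℕ → State → Prop where
  | nop (s : State) : Exec .nop s 1 s
  | assignNat (k : ℕ) (i e : NExpr) (s : State) :
      Exec (.assignNat k i e) s (i.cost + e.cost + 1) (s.setNat k (i.eval s) (e.eval s))
  | assignReal (k : ℕ) (i : NExpr) (e : RExpr) (s : State) :
      Exec (.assignReal k i e) s (i.cost + e.cost + 1) (s.setReal k (i.eval s) (e.eval s))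
  | seq {p q : Program} {s s₁ s₂ : State} {T₁ T₂ : ℕ} :
      Exec p s T₁ s₁ → Exec q s₁ T₂ s₂ → Exec (.seq p q) s (T₁ + T₂) s₂
  | branch_true {t : Test} {p q : Program} {s s₁ : State} {T : ℕ} :
      t.holds s → Exec p s T s₁ → Exec (.branch t p q) s (t.cost + T) s₁
  | branch_false {t : Test} {p q : Program} {s s₁ : State} {T : ℕ} :
      ¬ t.holds s → Exec q s T s₁ → Exec (.branch t p q) s (t.cost + T) s₁
  | loop_false {t : Test} {p : Program} {s : State} :
      ¬ t.holds s → Exec (.loop t p) s t.cost s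
  | loop_true {t : Test} {p : Program} {s s₁ s₂ : State} {T₁ T₂ : ℕ} :
      t.holds s → Exec p s T₁ s₁ → Exec (.loop t p) s₁ T₂ s₂ →
      Exec (.loop t p) s (t.cost + T₁ + T₂) s₂

end RealRAM

/-! ## Weighted unit-height 4M-labeling -/

namespace Labeling4M

/-- The (open) label of length `l` and height `1` with lower left corner `z`. -/
def label (l : ℝ) (z : ℝ × ℝ) : Set (ℝ × ℝ) :=
  Set.Ioo z.1 (z.1 + l) ×ˢ Set.Ioo z.2 (z.2 + 1)

/-- An instance of the weighted unit-height 4M-labeling problem: a finite set of points in the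
plane, listed in some order, with positive label lengths and nonnegative weights, and for each of
them a finite set of anchor points on the boundary of its label, again listed in some order.
Anchor points are given in coordinates relative to the lower left corner of the label. -/
structure Instance where
  n : ℕ
  point : Fin n → ℝ × ℝ
  point_injective : Function.Injective point
  length : Fin n → ℝ
  length_pos : ∀ i, 0 < length i
  weight : Fin n → ℝ
  weight_nonneg : ∀ i, 0 ≤ weight i
  anchors : Fin n → List (ℝ × ℝ)
  anchors_nodup : ∀ i, (anchors i).Nodup
  anchors_mem : ∀ i, ∀ a ∈ anchors i, a ∈ frontier (label (length i) (0, 0))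

namespace Instance

/-- The size of an instance: the number of points plus the total number of anchor points. -/
def size (I : Instance) : ℕ := I.n + ∑ i, (I.anchors i).length

/-- The weight of a set of points. -/
def weightOf (I : Instance) (Q : Finset (Fin I.n)) : ℝ := ∑ i ∈ Q, I.weight i

/-- `(Q, z)` is a labeling: `Q` is the set of points that receive a label, `z i` is the lower left
corner of the label of the `i`-th point for `i ∈ Q` (other values of `z` are irrelevant), one of the
anchor points of each placed label coincides with the point to be labeled, and placed labels do not
overlap. -/
def IsLabeling (I : Instance) (Q : Finset (Fin I.n)) (z : Fin I.n → ℝ × ℝ) : Prop :=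
  (∀ i ∈ Q, ∃ a ∈ I.anchors i, z i + a = I.point i) ∧
  ∀ i ∈ Q, ∀ j ∈ Q, i ≠ j → Disjoint (label (I.length i) (z i)) (label (I.length j) (z j))

/-- `(Q, z)` is a labeling of weight at least `(1 - ε)` times that of an optimal labeling. -/
def IsApproxLabeling (I : Instance) (ε : ℝ) (Q : Finset (Fin I.n)) (z : Fin I.n → ℝ × ℝ) : Prop :=
  I.IsLabeling Q z ∧ ∀ Q' z', I.IsLabeling Q' z' → (1 - ε) * I.weightOf Q' ≤ I.weightOf Q

/-- All anchor points in one list: those of the first point, those of the second one, and so on. -/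
def allAnchors (I : Instance) : List (ℝ × ℝ) := (List.ofFn I.anchors).flatten

/-- The array that holds the entries of a list, followed by zeros. -/
def arrayOf {α : Type} [Zero α] (L : List α) (i : ℕ) : α := L.getD i 0

/-- The initial memory.  Natural arrays: `0` holds the number of points at index `0`, and `1` holds
the numbers of anchor points.  Real arrays: `0`, `1` hold the coordinates of the points, `2` the
lengths, `3` the weights, `4`, `5` the coordinates of all anchor points, and `6` holds `ε` at
index `0`.  All other entries are zero. -/
noncomputable def input (I : Instance) (ε : ℝ) : RealRAM.State where
  nat k := match k with
    | 0 => arrayOf [I.n]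
    | 1 => arrayOf (List.ofFn fun i => (I.anchors i).length)
    | _ => fun _ => 0
  real k := match k with
    | 0 => arrayOf (List.ofFn fun i => (I.point i).1)
    | 1 => arrayOf (List.ofFn fun i => (I.point i).2)
    | 2 => arrayOf (List.ofFn I.length)
    | 3 => arrayOf (List.ofFn I.weight)
    | 4 => arrayOf (I.allAnchors.map Prod.fst)
    | 5 => arrayOf (I.allAnchors.map Prod.snd)
    | 6 => arrayOf [ε]
    | _ => fun _ => 0

/-- The set of labeled points that is read off the final memory: those with a nonzero entry in the
natural array `2`. -/
def outputSet (I : Instance) (s : RealRAM.State) : Finset (Fin I.n) :=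
  Finset.univ.filter fun i => s.nat 2 i ≠ 0

/-- The label positions that are read off the final memory: the real arrays `7` and `8`. -/
def outputPos (I : Instance) (s : RealRAM.State) (i : Fin I.n) : ℝ × ℝ :=
  (s.real 7 i, s.real 8 i)

end Instance

/-- On input `I` and `ε`, the program halts after at most `B` steps and its output is a labeling of
`I` of weight at least `(1 - ε)` times the weight of an optimal labeling. -/
def SolvesWithin (prog : RealRAM.Program) (I : Instance) (ε B : ℝ) : Prop :=
  ∃ (T : ℕ) (s : RealRAM.State), RealRAM.Exec prog (I.input ε) T s ∧ (T : ℝ) ≤ B ∧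
    I.IsApproxLabeling ε (I.outputSet s) (I.outputPos s)

/-- The program is a polynomial-time approximation scheme: for every fixed `ε > 0` it is a
polynomial-time `(1 - ε)`-approximation algorithm. -/
def IsPTAS (prog : RealRAM.Program) : Prop :=
  ∀ ε : ℝ, 0 < ε → ∃ p : Polynomial ℕ, ∀ I : Instance, SolvesWithin prog I ε (p.eval I.size : ℕ)

end Labeling4M

/-!
The approximation scheme is a single dynamic program over tuples of `O(1 / ε)` candidate labels, run
on top of the shifting technique of Hochbaum and Maass.

*Candidates.*  A pair of a point and one of its anchor points determines a candidate label.  A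
labeling is a set of candidates that are pairwise independent: they belong to different points and
their open rectangles are disjoint (`Lists.isLabeling`, `Lists.exists_cands`).

*Shifting.*  Let `M = ⌈1 / ε⌉`.  Deleting from an optimal labeling all labels whose lower edge `y`
has `⌈y⌉ ≡ c` modulo `M`, for the best residue `c`, costs at most the fraction `1 / M ≤ ε` of the
weight, and splits the rest into slabs that are vertically separated.  In a slab no vertical line
meets more than `2 * M` labels (`Cands.Dominates.one_sub_mul_le`).

*Dynamic program.*  The program neither rounds coordinates nor knows the slabs.  A state consists of
two labels, the floor and the ceiling of the current slab, and of `2 * M` slots that hold labels or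
are empty.  A step either opens a new slab strictly above the ceiling of the current one and
empties the slots, or adds to the current slab a label `r` that lies weakly to the right, in the
order of the left edges, of all labels in the slots and is independent of them.  The label `r` is
put into a slot, and slots may be overwritten only if their label ends strictly to the left of `r`.
A forgotten label is thus separated from all later ones as a closed rectangle, so it can neither
overlap a later label nor share its point with one; this is why every walk from the empty state
yields a labeling (`Cands.Inv.switch`, `Cands.Inv.add`).  Conversely, the labels of a slab, sorted by
their left edges, can be added one by one, since there is always a slot that may be overwritten
(`Cands.Dominates.slab`).  So a heaviest walk yields a labeling of weight at least `1 - ε` times the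
optimum.

*Program.*  With `N` candidates there are `(N + 1) ^ (2 * M + 2)` states, which are numbered by their
digits in base `N + 1`, and walks of `2 * N` steps suffice.  The program tabulates for every number
of steps and every state the first step of a heaviest walk, testing all pairs of states, and then
follows a heaviest walk.  Its correctness is shown with a Hoare logic for total correctness, `Runs`.
Running times are not tracked through it: every loop makes at most `max 2 n ^ (8 * M)` iterations on
instances of size `n`, and for a fixed program the running time is polynomial in the number of loop iterations
(`Program.exists_timeBound_le`).
-/

/-! ### Total correctness with time bounds -/

namespace RealRAM

@[simp] theorem State.setNat_nat_same (s : State) (k i v : ℕ) :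
    (s.setNat k i v).nat k = Function.update (s.nat k) i v := by
  simp [State.setNat]

@[simp] theorem State.setNat_nat_of_ne (s : State) (k i v : ℕ) {k' : ℕ} (h : k' ≠ k) :
    (s.setNat k i v).nat k' = s.nat k' := by
  simp [State.setNat, h]

@[simp] theorem State.setNat_real (s : State) (k i v : ℕ) : (s.setNat k i v).real = s.real := rfl

@[simp] theorem State.setReal_real_same (s : State) (k i : ℕ) (v : ℝ) :
    (s.setReal k i v).real k = Function.update (s.real k) i v := by
  simp [State.setReal]

@[simp] theorem State.setReal_real_of_ne (s : State) (k i : ℕ) (v : ℝ) {k' : ℕ} (h : k' ≠ k) :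
    (s.setReal k i v).real k' = s.real k' := by
  simp [State.setReal, h]

@[simp] theorem State.setReal_nat (s : State) (k i : ℕ) (v : ℝ) :
    (s.setReal k i v).nat = s.nat := rfl

attribute [simp] NExpr.eval RExpr.eval Test.holds

/-- A bound for the running time of a program each of whose loops makes at most `Z` iterations
whenever it is entered. -/
def Program.timeBound (Z : ℕ) : Program → ℕ
  | .nop => 1
  | .assignNat _ i e => i.cost + e.cost + 1
  | .assignReal _ i e => i.cost + e.cost + 1
  | .seq p q => p.timeBound Z + q.timeBound Z
  | .branch t p q => t.cost + (p.timeBound Z + q.timeBound Z)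
  | .loop t p => t.cost + Z * (t.cost + p.timeBound Z)

/-- For a fixed program the time bound is polynomial in the number of loop iterations. -/
theorem Program.exists_timeBound_le (p : Program) :
    ∃ c e : ℕ, ∀ Z, p.timeBound Z ≤ c * (Z + 1) ^ e := by
  induction p with
  | nop => exact ⟨1, 0, fun Z => by simp [timeBound]⟩
  | assignNat k i e => exact ⟨i.cost + e.cost + 1, 0, fun Z => by simp [timeBound]⟩
  | assignReal k i e => exact ⟨i.cost + e.cost + 1, 0, fun Z => by simp [timeBound]⟩
  | seq p q hp hq =>
    obtain ⟨c, e, h⟩ := hp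
    obtain ⟨c', e', h'⟩ := hq
    refine ⟨c + c', e + e', fun Z => ?_⟩
    have h1 : (Z + 1) ^ e ≤ (Z + 1) ^ (e + e') := Nat.pow_le_pow_right (by omega) (by omega)
    have h2 : (Z + 1) ^ e' ≤ (Z + 1) ^ (e + e') := Nat.pow_le_pow_right (by omega) (by omega)
    calc p.timeBound Z + q.timeBound Z ≤ c * (Z + 1) ^ e + c' * (Z + 1) ^ e' := add_le_add (h Z) (h' Z)
      _ ≤ c * (Z + 1) ^ (e + e') + c' * (Z + 1) ^ (e + e') := by gcongr
      _ = _ := by ring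
  | branch t p q hp hq =>
    obtain ⟨c, e, h⟩ := hp
    obtain ⟨c', e', h'⟩ := hq
    refine ⟨t.cost + (c + c'), e + e', fun Z => ?_⟩
    have h1 : (Z + 1) ^ e ≤ (Z + 1) ^ (e + e') := Nat.pow_le_pow_right (by omega) (by omega)
    have h2 : (Z + 1) ^ e' ≤ (Z + 1) ^ (e + e') := Nat.pow_le_pow_right (by omega) (by omega)
    have h3 : 1 ≤ (Z + 1) ^ (e + e') := Nat.one_le_pow _ _ (by omega)
    calc t.cost + (p.timeBound Z + q.timeBound Z)
        ≤ t.cost * 1 + (c * (Z + 1) ^ e + c' * (Z + 1) ^ e') := by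
          have := h Z; have := h' Z; omega
      _ ≤ t.cost * (Z + 1) ^ (e + e') + (c * (Z + 1) ^ (e + e') + c' * (Z + 1) ^ (e + e')) := by
          gcongr
      _ = _ := by ring
  | loop t p hp =>
    obtain ⟨c, e, h⟩ := hp
    refine ⟨2 * t.cost + c, e + 1, fun Z => ?_⟩
    have h1 : (Z + 1) ^ e ≤ (Z + 1) ^ (e + 1) := Nat.pow_le_pow_right (by omega) (by omega)
    have h3 : 1 ≤ (Z + 1) ^ e := Nat.one_le_pow _ _ (by omega)
    calc t.cost + Z * (t.cost + p.timeBound Z)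
        ≤ t.cost * 1 + (Z + 1) * (t.cost * 1 + c * (Z + 1) ^ e) := by
          rw [mul_one]
          exact Nat.add_le_add_left (Nat.mul_le_mul (by omega) (by have := h Z; omega)) _
      _ ≤ t.cost * (Z + 1) ^ (e + 1) + (Z + 1) * (t.cost * (Z + 1) ^ e + c * (Z + 1) ^ e) := by
          gcongr; exact h3.trans h1
      _ = _ := by ring

/-- `p.writesNat k`: the program contains an assignment to the natural array `k`. -/
def Program.writesNat (k : ℕ) : Program → Bool
  | .nop => false
  | .assignNat k' _ _ => k == k'
  | .assignReal _ _ _ => false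
  | .seq p q => p.writesNat k || q.writesNat k
  | .branch _ p q => p.writesNat k || q.writesNat k
  | .loop _ p => p.writesNat k

/-- `p.writesReal k`: the program contains an assignment to the real array `k`. -/
def Program.writesReal (k : ℕ) : Program → Bool
  | .nop => false
  | .assignNat _ _ _ => false
  | .assignReal k' _ _ => k == k'
  | .seq p q => p.writesReal k || q.writesReal k
  | .branch _ p q => p.writesReal k || q.writesReal k
  | .loop _ p => p.writesReal k

/-- `Frame p s s'`: the memory states `s` and `s'` agree on all arrays to which `p` does not
assign. -/
def Frame (p : Program) (s s' : State) : Prop :=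
  (∀ k, p.writesNat k = false → s'.nat k = s.nat k) ∧
  ∀ k, p.writesReal k = false → s'.real k = s.real k

theorem Exec.frame {p : Program} {s s' : State} {T : ℕ} (h : Exec p s T s') : Frame p s s' := by
  induction h with
  | nop => exact ⟨fun _ _ => rfl, fun _ _ => rfl⟩
  | assignNat k i e s =>
    refine ⟨fun k' hk => ?_, fun _ _ => rfl⟩
    exact State.setNat_nat_of_ne _ _ _ _ (by simpa [Program.writesNat] using hk)
  | assignReal k i e s =>
    refine ⟨fun _ _ => rfl, fun k' hk => ?_⟩
    exact State.setReal_real_of_ne _ _ _ _ (by simpa [Program.writesReal] using hk)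
  | seq _ _ h1 h2 =>
    refine ⟨fun k hk => ?_, fun k hk => ?_⟩
    · simp only [Program.writesNat, Bool.or_eq_false_iff] at hk
      rw [h2.1 k hk.2, h1.1 k hk.1]
    · simp only [Program.writesReal, Bool.or_eq_false_iff] at hk
      rw [h2.2 k hk.2, h1.2 k hk.1]
  | branch_true _ _ h1 =>
    refine ⟨fun k hk => ?_, fun k hk => ?_⟩
    · simp only [Program.writesNat, Bool.or_eq_false_iff] at hk
      exact h1.1 k hk.1
    · simp only [Program.writesReal, Bool.or_eq_false_iff] at hk
      exact h1.2 k hk.1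
  | branch_false _ _ h1 =>
    refine ⟨fun k hk => ?_, fun k hk => ?_⟩
    · simp only [Program.writesNat, Bool.or_eq_false_iff] at hk
      exact h1.1 k hk.2
    · simp only [Program.writesReal, Bool.or_eq_false_iff] at hk
      exact h1.2 k hk.2
  | loop_false => exact ⟨fun _ _ => rfl, fun _ _ => rfl⟩
  | loop_true _ _ _ h1 h2 =>
    exact ⟨fun k hk => (h2.1 k hk).trans (h1.1 k hk), fun k hk => (h2.2 k hk).trans (h1.2 k hk)⟩

/-- Total correctness: started in `s`, the program halts within the time that `Program.timeBound`
allows for loops of at most `Z` iterations, in a memory state that satisfies `Q`. -/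
def Runs (Z : ℕ) (p : Program) (s : State) (Q : State → Prop) : Prop :=
  ∃ T ≤ p.timeBound Z, ∃ s', Exec p s T s' ∧ Q s'

namespace Runs

variable {Z : ℕ} {p q : Program} {s : State} {Q R : State → Prop}

theorem mono (h : Runs Z p s R) (hQ : ∀ s', R s' → Frame p s s' → Q s') : Runs Z p s Q := by
  obtain ⟨T, hT, s', he, hR⟩ := h
  exact ⟨T, hT, s', he, hQ s' hR he.frame⟩

theorem nop (h : Q s) : Runs Z .nop s Q := ⟨1, le_rfl, s, .nop s, h⟩

theorem assignNat {k : ℕ} {i e : NExpr} (h : Q (s.setNat k (i.eval s) (e.eval s))) :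
    Runs Z (.assignNat k i e) s Q :=
  ⟨_, le_rfl, _, .assignNat k i e s, h⟩

theorem assignReal {k : ℕ} {i : NExpr} {e : RExpr} (h : Q (s.setReal k (i.eval s) (e.eval s))) :
    Runs Z (.assignReal k i e) s Q :=
  ⟨_, le_rfl, _, .assignReal k i e s, h⟩

theorem seq (hp : Runs Z p s R) (hq : ∀ s', R s' → Frame p s s' → Runs Z q s' Q) :
    Runs Z (.seq p q) s Q := by
  obtain ⟨T, hT, s', he, hR⟩ := hp
  obtain ⟨T', hT', s'', he', hQ⟩ := hq s' hR he.frame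
  exact ⟨T + T', add_le_add hT hT', s'', .seq he he', hQ⟩

theorem assignNat_seq {k : ℕ} {i e : NExpr}
    (h : Runs Z q (s.setNat k (i.eval s) (e.eval s)) Q) :
    Runs Z (.seq (.assignNat k i e) q) s Q :=
  seq (R := fun s' => s' = s.setNat k (i.eval s) (e.eval s)) (assignNat rfl)
    (by rintro _ rfl _; exact h)

theorem assignReal_seq {k : ℕ} {i : NExpr} {e : RExpr}
    (h : Runs Z q (s.setReal k (i.eval s) (e.eval s)) Q) :
    Runs Z (.seq (.assignReal k i e) q) s Q :=
  seq (R := fun s' => s' = s.setReal k (i.eval s) (e.eval s)) (assignReal rfl)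
    (by rintro _ rfl _; exact h)

theorem branch {t : Test} (hp : t.holds s → Runs Z p s Q) (hq : ¬ t.holds s → Runs Z q s Q) :
    Runs Z (.branch t p q) s Q := by
  by_cases ht : t.holds s
  · obtain ⟨T, hT, s', he, hQ⟩ := hp ht
    exact ⟨_, by simp only [Program.timeBound]; omega, s', .branch_true ht he, hQ⟩
  · obtain ⟨T, hT, s', he, hQ⟩ := hq ht
    exact ⟨_, by simp only [Program.timeBound]; omega, s', .branch_false ht he, hQ⟩

/-- The rule for loops that make exactly `n` iterations; `I i` holds after `i` of them. -/
theorem loop {t : Test} {n : ℕ} (hn : n ≤ Z) (I : ℕ → State → Prop) (h0 : I 0 s)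
    (hstep : ∀ i < n, ∀ s', I i s' → t.holds s' ∧ Runs Z p s' (I (i + 1)))
    (hend : ∀ s', I n s' → ¬ t.holds s') (hQ : ∀ s', I n s' → Q s') :
    Runs Z (.loop t p) s Q := by
  have key : ∀ j ≤ n, ∀ s', I (n - j) s' → ∃ T ≤ t.cost + j * (t.cost + p.timeBound Z),
      ∃ s'', Exec (.loop t p) s' T s'' ∧ Q s'' := by
    intro j
    induction j with
    | zero =>
      intro _ s' hs'
      exact ⟨_, by omega, s', .loop_false (hend s' hs'), hQ s' hs'⟩
    | succ j ih =>
      intro hj s' hs'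
      obtain ⟨ht, T, hT, s₁, he, hI⟩ := hstep (n - (j + 1)) (by omega) s' hs'
      rw [show n - (j + 1) + 1 = n - j by omega] at hI
      obtain ⟨T', hT', s₂, he', hs₂⟩ := ih (by omega) s₁ hI
      refine ⟨_, ?_, s₂, .loop_true ht he he', hs₂⟩
      rw [Nat.add_mul, one_mul]
      omega
  obtain ⟨T, hT, s', he, hs'⟩ := key n le_rfl s (by simpa using h0)
  refine ⟨T, hT.trans ?_, s', he, hs'⟩
  exact Nat.add_le_add_left (Nat.mul_le_mul_right _ hn) _

end Runs

/-- The value of the natural variable `k`, which is kept at index `0` of the `k`-th array. -/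
abbrev NExpr.var (k : ℕ) : NExpr := .read k (.lit 0)

/-- The value of the real variable `k`, which is kept at index `0` of the `k`-th array. -/
abbrev RExpr.var (k : ℕ) : RExpr := .read k (.lit 0)

/-- `for x := 0, …, y - 1 do body`; the counter `x` and the bound `y` are variables to which the
body must not assign. -/
def Program.forTo (x y : ℕ) (body : Program) : Program :=
  .seq (.assignNat x (.lit 0) (.lit 0))
    (.loop (.neg (.natLe (.var y) (.var x)))
      (.seq body (.assignNat x (.lit 0) (.add (.var x) (.lit 1)))))

/-- The rule for counting loops: `I i` holds when the counter has the value `i`.  The arrays to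
which the loop does not assign are known to be unchanged all the time. -/
theorem Runs.forTo {Z x y : ℕ} {body : Program} {s : State} {Q : State → Prop} (n : ℕ)
    (hy : s.nat y 0 = n) (hn : n ≤ Z)
    (hxb : body.writesNat x = false) (hyb : body.writesNat y = false) (hxy : y ≠ x)
    (I : ℕ → State → Prop) (h0 : I 0 (s.setNat x 0 0))
    (hstep : ∀ i < n, ∀ s', I i s' → s'.nat x 0 = i → Frame (Program.forTo x y body) s s' →
      Runs Z body s' (fun s'' => I (i + 1) (s''.setNat x 0 (i + 1))))
    (hQ : ∀ s', I n s' → Frame (Program.forTo x y body) s s' → Q s') :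
    Runs Z (Program.forTo x y body) s Q := by
  subst hy
  have hfy : (Program.forTo x y body).writesNat y = false := by
    simp [Program.forTo, Program.writesNat, hyb, hxy]
  refine assignNat_seq (loop hn
    (fun i s' => I i s' ∧ s'.nat x 0 = i ∧ Frame (Program.forTo x y body) s s') ?_ ?_ ?_ ?_)
  · refine ⟨h0, by simp, ?_, fun _ _ => rfl⟩
    intro k hk
    refine State.setNat_nat_of_ne _ _ _ _ ?_
    rintro rfl
    simp [Program.forTo, Program.writesNat] at hk
  · rintro i hi s' ⟨hI, hx, hf⟩
    have hs'y : s'.nat y = s.nat y := hf.1 y hfy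
    refine ⟨by simpa [hx, hs'y] using hi, seq (hstep i hi s' hI hx hf) ?_⟩
    intro s'' hI'' hf'
    have hx'' : s''.nat x 0 = i := by rw [hf'.1 x hxb, hx]
    refine assignNat ?_
    simp only [NExpr.eval, hx'']
    refine ⟨hI'', by simp, ?_, ?_⟩
    · intro k hk
      rw [← hf.1 k hk]
      simp only [Program.forTo, Program.writesNat, Bool.or_eq_false_iff, beq_eq_false_iff_ne] at hk
      rw [State.setNat_nat_of_ne _ _ _ _ hk.1, hf'.1 k hk.2.1]
    · intro k hk
      rw [← hf.2 k hk]
      simp only [Program.forTo, Program.writesReal, Bool.or_eq_false_iff] at hk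
      rw [State.setNat_real, hf'.2 k hk.2.1]
  · rintro s' ⟨_, hx, hf⟩
    simp [hx, hf.1 y hfy]
  · rintro s' ⟨hI, _, hf⟩
    exact hQ s' hI hf

end RealRAM

/-! ### Candidate labels and the transition system of the dynamic program -/

namespace Labeling4M

/-- The data of the candidate labels, which are numbered from `1` on; the number `0` stands for "no
label".  Candidate `r` labels the point with number `pt r`, occupies `[lx r, rx r] × [ly r, ly r + 1]`
and has weight `wt r`. -/
structure Cands where
  pt : ℕ → ℕ
  lx : ℕ → ℝ
  rx : ℕ → ℝ
  ly : ℕ → ℝ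
  wt : ℕ → ℝ

namespace Cands

variable (C : Cands)

/-- Two candidates label different points and do not overlap. -/
def Indep (s r : ℕ) : Prop :=
  C.pt s ≠ C.pt r ∧
    (C.rx s ≤ C.lx r ∨ C.rx r ≤ C.lx s ∨ C.ly s + 1 ≤ C.ly r ∨ C.ly r + 1 ≤ C.ly s)

/-- The properties of the candidates `1, …, N` that the dynamic program relies on: lengths are
positive, weights nonnegative, and each candidate touches its point. -/
structure Proper (N : ℕ) : Prop where
  lt : ∀ r, 1 ≤ r → r ≤ N → C.lx r < C.rx r
  wt_nonneg : ∀ r, 1 ≤ r → r ≤ N → 0 ≤ C.wt r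
  wt_zero : C.wt 0 = 0
  touch : ∃ loc : ℕ → ℝ × ℝ, ∀ r, 1 ≤ r → r ≤ N →
    (C.lx r ≤ (loc (C.pt r)).1 ∧ (loc (C.pt r)).1 ≤ C.rx r) ∧
    (C.ly r ≤ (loc (C.pt r)).2 ∧ (loc (C.pt r)).2 ≤ C.ly r + 1)

variable {C}

theorem Indep.symm {s r : ℕ} (h : C.Indep s r) : C.Indep r s :=
  ⟨h.1.symm, by rcases h.2 with h | h | h | h <;> simp [h]⟩

variable (C)

/-- The condition on the contents `f` and `g` of a slot before and after the label `r` is added: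
`r` lies to the right of `f` in the order of the left edges and is independent of `f`, and `f` is
kept unless it ends strictly to the left of `r`. -/
def SlotOK (f r g : ℕ) : Prop :=
  f = 0 ∨ (C.lx f ≤ C.lx r ∧ C.Indep f r ∧ (g = f ∨ C.rx f < C.lx r))

/-- The transition of the dynamic program that opens a new slab.  The digits of a state `f` are the
floor `f 0`, the ceiling `f 1` and `m` slots `f 2, …, f (m + 1)`.  The current slab consists of the
labels that lie strictly above the label `f 0` and start no higher than the label `f 1`. -/
def Switch (m : ℕ) (f g : ℕ → ℕ) : Prop :=
  g 0 = f 1 ∧ (f 1 = 0 ∨ (g 1 ≠ 0 ∧ C.ly (f 1) ≤ C.ly (g 1))) ∧ ∀ i < m, g (i + 2) = 0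

/-- The transition of the dynamic program that adds the label `r` of the current slab. -/
def Add (m : ℕ) (f : ℕ → ℕ) (r : ℕ) (g : ℕ → ℕ) : Prop :=
  (r ≠ 0 ∧ (f 0 = 0 ∨ C.ly (f 0) + 1 < C.ly r) ∧ f 1 ≠ 0 ∧ C.ly r ≤ C.ly (f 1) ∧
    g 0 = f 0 ∧ g 1 = f 1) ∧
  (∀ i < m, C.SlotOK (f (i + 2)) r (g (i + 2))) ∧ ∃ i < m, g (i + 2) = r

/-- A transition of the dynamic program: it adds the label `r`, or opens a new slab if `r = 0`. -/
def Step (m : ℕ) (f : ℕ → ℕ) (r : ℕ) (g : ℕ → ℕ) : Prop :=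
  (r = 0 ∧ C.Switch m f g) ∨ C.Add m f r g

/-- The invariant of the walks of the dynamic program: the labels in `S` are pairwise independent,
and each of them is below the current slab, is remembered in a slot, or ends strictly to the left
of a label that is remembered in a slot.  None of them starts higher than the ceiling, so that all
of them are below the next slab. -/
structure Inv (m N : ℕ) (f : ℕ → ℕ) (S : Finset ℕ) : Prop where
  pos : ∀ s ∈ S, 1 ≤ s
  le : ∀ s ∈ S, s ≤ N
  indep : ∀ s ∈ S, ∀ r ∈ S, s ≠ r → C.Indep s r
  below : ∀ s ∈ S, f 1 ≠ 0 ∧ C.ly s ≤ C.ly (f 1)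
  cover : ∀ s ∈ S, (f 0 ≠ 0 ∧ C.ly s ≤ C.ly (f 0)) ∨
    ∃ i < m, f (i + 2) ≠ 0 ∧ (f (i + 2) = s ∨ C.rx s < C.lx (f (i + 2)))

variable {C}

theorem Proper.indep_of_rx_lt {N s r : ℕ} (hC : C.Proper N) (hs : 1 ≤ s) (hs' : s ≤ N) (hr : 1 ≤ r)
    (hr' : r ≤ N) (h : C.rx s < C.lx r) : C.Indep s r := by
  obtain ⟨loc, hloc⟩ := hC.touch
  refine ⟨fun he => ?_, Or.inl h.le⟩
  have h1 := (hloc s hs hs').1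
  have h2 := (hloc r hr hr').1
  rw [he] at h1
  linarith [h1.2, h2.1]

theorem Proper.indep_of_ly_lt {N s r : ℕ} (hC : C.Proper N) (hs : 1 ≤ s) (hs' : s ≤ N) (hr : 1 ≤ r)
    (hr' : r ≤ N) (h : C.ly s + 1 < C.ly r) : C.Indep s r := by
  obtain ⟨loc, hloc⟩ := hC.touch
  refine ⟨fun he => ?_, Or.inr (Or.inr (Or.inl h.le))⟩
  have h1 := (hloc s hs hs').2
  have h2 := (hloc r hr hr').2
  rw [he] at h1
  linarith [h1.2, h2.1]

theorem Inv.switch {m N : ℕ} {f g : ℕ → ℕ} {S : Finset ℕ} (h : C.Inv m N f S)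
    (hs : C.Switch m f g) : C.Inv m N g S where
  pos := h.pos
  le := h.le
  indep := h.indep
  below s hS := by
    obtain ⟨h1, h2⟩ := h.below s hS
    obtain ⟨h3, h4⟩ := hs.2.1.resolve_left h1
    exact ⟨h3, h2.trans h4⟩
  cover s hS := Or.inl (by rw [hs.1]; exact h.below s hS)

theorem Inv.indep_of_add {m N : ℕ} {f g : ℕ → ℕ} {S : Finset ℕ} {r : ℕ} (hC : C.Proper N)
    (h : C.Inv m N f S) (ha : C.Add m f r g) (hr : r ≤ N) {s : ℕ} (hs : s ∈ S) : C.Indep s r := by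
  obtain ⟨⟨hr0, h0, h1, hr1, hg0, hg1⟩, hsl, -⟩ := ha
  have hr' : 1 ≤ r := Nat.one_le_iff_ne_zero.2 hr0
  rcases h.cover s hs with ⟨h2, h3⟩ | ⟨i, hi, h2, h3⟩
  · exact hC.indep_of_ly_lt (h.pos s hs) (h.le s hs) hr' hr (by
      linarith [h0.resolve_left h2])
  · obtain ⟨h4, h5, -⟩ := (hsl i hi).resolve_left h2
    rcases h3 with h3 | h3
    · rwa [← h3]
    · exact hC.indep_of_rx_lt (h.pos s hs) (h.le s hs) hr' hr (h3.trans_le h4)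

theorem Inv.add {m N : ℕ} {f g : ℕ → ℕ} {S : Finset ℕ} {r : ℕ} (hC : C.Proper N)
    (h : C.Inv m N f S) (ha : C.Add m f r g) (hr : r ≤ N) :
    r ∉ S ∧ C.Inv m N g (insert r S) := by
  have hind : ∀ s ∈ S, C.Indep s r := fun s hs => h.indep_of_add hC ha hr hs
  obtain ⟨⟨hr0, h0, h1, hr1, hg0, hg1⟩, hsl, j, hj, hgj⟩ := ha
  have hr' : 1 ≤ r := Nat.one_le_iff_ne_zero.2 hr0
  refine ⟨fun hrS => (hind r hrS).1 rfl, ?_, ?_, ?_, ?_, ?_⟩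
  · simpa [hr'] using h.pos
  · simpa [hr] using h.le
  · intro s hs u hu hsu
    rcases Finset.mem_insert.1 hs with rfl | hs' <;> rcases Finset.mem_insert.1 hu with rfl | hu'
    · exact absurd rfl hsu
    · exact (hind u hu').symm
    · exact hind s hs'
    · exact h.indep s hs' u hu' hsu
  · intro s hs
    rw [hg1]
    rcases Finset.mem_insert.1 hs with rfl | hs
    · exact ⟨h1, hr1⟩
    · exact h.below s hs
  · intro s hs
    rcases Finset.mem_insert.1 hs with rfl | hs
    · exact Or.inr ⟨j, hj, by rw [hgj]; exact hr0, Or.inl hgj⟩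
    · rw [hg0]
      refine (h.cover s hs).imp id ?_
      rintro ⟨i, hi, h2, h3⟩
      obtain ⟨h4, -, h5⟩ := (hsl i hi).resolve_left h2
      have hdead : C.rx s < C.lx r → ∃ i < m, g (i + 2) ≠ 0 ∧
          (g (i + 2) = s ∨ C.rx s < C.lx (g (i + 2))) := fun hd =>
        ⟨j, hj, by rw [hgj]; exact hr0, Or.inr (by rwa [hgj])⟩
      rcases h3 with h3 | h3
      · rcases h5 with h5 | h5
        · exact ⟨i, hi, by rw [h5]; exact h2, Or.inl (by rw [h5, h3])⟩
        · exact hdead (by rwa [h3] at h5)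
      · exact hdead (h3.trans_le h4)

/-! ### States as numbers -/

/-- The digit with index `i` of the number `t` in base `b`. -/
def dig (b t i : ℕ) : ℕ := t / b ^ i % b

@[simp] theorem dig_zero (b i : ℕ) : dig b 0 i = 0 := by simp [dig]

theorem exists_dig {b : ℕ} (d : ℕ) (g : ℕ → ℕ) (hg : ∀ i < d, g i < b) :
    ∃ t < b ^ d, ∀ i < d, dig b t i = g i := by
  induction d generalizing g with
  | zero => exact ⟨0, by simp, by simp⟩
  | succ d ih =>
    have hb : 0 < b := (Nat.zero_le _).trans_lt (hg 0 (by omega))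
    obtain ⟨t, ht, hdig⟩ := ih (fun i => g (i + 1)) (fun i hi => hg (i + 1) (by omega))
    refine ⟨g 0 + b * t, ?_, fun i hi => ?_⟩
    · calc g 0 + b * t < b + b * t := by have := hg 0 (by omega); omega
        _ = b * (t + 1) := by ring
        _ ≤ b * b ^ d := Nat.mul_le_mul_left _ ht
        _ = b ^ (d + 1) := by ring
    · cases i with
      | zero => simp [dig, Nat.mod_eq_of_lt (hg 0 (by omega))]
      | succ i =>
        rw [← hdig i (by omega), dig, dig, pow_succ', ← Nat.div_div_eq_div_mul,
          Nat.add_mul_div_left _ _ hb, Nat.div_eq_of_lt (hg 0 (by omega)), zero_add]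

/-! ### Lower bounds for the value table -/

/-- The part of the specification of the value table that bounds it from below: `val l t` is at
least the weight of every walk of at most `l` steps that starts in the state `t`. -/
structure Dominates (C : Cands) (m N L : ℕ) (val : ℕ → ℕ → ℝ) : Prop where
  nonneg : ∀ t < (N + 1) ^ (m + 2), 0 ≤ val 0 t
  mono : ∀ l < L, ∀ t < (N + 1) ^ (m + 2), val l t ≤ val (l + 1) t
  step : ∀ l < L, ∀ t < (N + 1) ^ (m + 2), ∀ r ≤ N, ∀ u < (N + 1) ^ (m + 2),
    C.Step m (dig (N + 1) t) r (dig (N + 1) u) → C.wt r + val l u ≤ val (l + 1) t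

theorem Dominates.mono_le {m N L : ℕ} {val : ℕ → ℕ → ℝ} (h : Dominates C m N L val) {l l' : ℕ}
    (hl : l ≤ l') (hL : l' ≤ L) {t : ℕ} (ht : t < (N + 1) ^ (m + 2)) : val l t ≤ val l' t := by
  induction l', hl using Nat.le_induction with
  | base => rfl
  | succ k hk ih => exact (ih (by omega)).trans (h.mono k (by omega) t ht)

/-- The labels of one slab can be added in the order of their left edges: when `r` is added, fewer
than `m` of the earlier labels of the slab reach the left edge of `r`, so one of the slots can be
reused. -/
theorem Dominates.slab {m N L : ℕ} {val : ℕ → ℕ → ℝ} (h : Dominates C m N L val)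
    (S : Finset ℕ) (hpos : ∀ r ∈ S, 1 ≤ r) (hN : ∀ r ∈ S, r ≤ N)
    (hlt : ∀ r ∈ S, C.lx r < C.rx r)
    (hind : ∀ s ∈ S, ∀ r ∈ S, s ≠ r → C.Indep s r)
    (hdens : ∀ r ∈ S, (S.filter fun s => C.lx s ≤ C.lx r ∧ C.lx r ≤ C.rx s).card ≤ m)
    (todo : List ℕ) (hS : ∀ r ∈ todo, r ∈ S) (hsort : todo.Pairwise fun s r => C.lx s ≤ C.lx r)
    (hnd : todo.Nodup) (t : ℕ) (ht : t < (N + 1) ^ (m + 2))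
    (hfl : ∀ r ∈ todo, dig (N + 1) t 0 = 0 ∨ C.ly (dig (N + 1) t 0) + 1 < C.ly r)
    (hce : ∀ r ∈ todo, dig (N + 1) t 1 ≠ 0 ∧ C.ly r ≤ C.ly (dig (N + 1) t 1))
    (hslot : ∀ i < m, dig (N + 1) t (i + 2) = 0 ∨ (dig (N + 1) t (i + 2) ∈ S ∧
      dig (N + 1) t (i + 2) ∉ todo ∧ ∀ r ∈ todo, C.lx (dig (N + 1) t (i + 2)) ≤ C.lx r))
    (hinj : ∀ i < m, ∀ j < m, dig (N + 1) t (i + 2) = dig (N + 1) t (j + 2) →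
      dig (N + 1) t (i + 2) ≠ 0 → i = j) :
    ∃ t' < (N + 1) ^ (m + 2), dig (N + 1) t' 1 = dig (N + 1) t 1 ∧
      ∀ l, l + todo.length ≤ L → (todo.map C.wt).sum + val l t' ≤ val (l + todo.length) t := by
  induction todo generalizing t with
  | nil => exact ⟨t, ht, rfl, fun l _ => by simp⟩
  | cons r todo ih =>
    set f := dig (N + 1) t with hf
    have hrS : r ∈ S := hS r (by simp)
    have hr1 := hpos r hrS
    rw [List.pairwise_cons] at hsort
    rw [List.nodup_cons] at hnd
    -- If no slot could be reused, the labels in the slots together with `r` would be too many.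
    obtain ⟨j, hj, hfree⟩ : ∃ j < m, f (j + 2) = 0 ∨ C.rx (f (j + 2)) < C.lx r := by
      by_contra! hcon
      have hsub : (Finset.range m).image (fun i => f (i + 2)) ⊆
          (S.filter fun s => C.lx s ≤ C.lx r ∧ C.lx r ≤ C.rx s).erase r := by
        intro s hs
        obtain ⟨i, hi, rfl⟩ := Finset.mem_image.1 hs
        have hi := Finset.mem_range.1 hi
        obtain ⟨h1, h2⟩ := hcon i hi
        obtain ⟨h3, h4, h5⟩ := (hslot i hi).resolve_left h1
        refine Finset.mem_erase.2 ⟨fun he => h4 (by rw [he]; simp), Finset.mem_filter.2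
          ⟨h3, h5 r (by simp), h2⟩⟩
      have hcard := Finset.card_le_card hsub
      rw [Finset.card_image_of_injOn, Finset.card_range, Finset.card_erase_of_mem] at hcard
      · have := hdens r hrS
        have : 0 < (S.filter fun s => C.lx s ≤ C.lx r ∧ C.lx r ≤ C.rx s).card :=
          Finset.card_pos.2 ⟨r, Finset.mem_filter.2 ⟨hrS, le_rfl, (hlt r hrS).le⟩⟩
        omega
      · exact Finset.mem_filter.2 ⟨hrS, le_rfl, (hlt r hrS).le⟩
      · intro i hi i' hi' he
        have hi := Finset.mem_range.1 hi
        exact hinj i hi i' (Finset.mem_range.1 hi') he (hcon i hi).1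
    obtain ⟨u, hu, hdu⟩ := exists_dig (b := N + 1) (m + 2) (Function.update f (j + 2) r) (by
      intro i hi
      by_cases hij : i = j + 2
      · rw [hij, Function.update_self]; have := hN r hrS; omega
      · rw [Function.update_of_ne hij]; exact Nat.mod_lt _ (by omega))
    set g := dig (N + 1) u with hg
    have hg0 : g 0 = f 0 := by rw [hdu 0 (by omega), Function.update_of_ne (by omega)]
    have hg1 : g 1 = f 1 := by rw [hdu 1 (by omega), Function.update_of_ne (by omega)]
    have hgj : g (j + 2) = r := by rw [hdu _ (by omega), Function.update_self]
    have hgi : ∀ i < m, i ≠ j → g (i + 2) = f (i + 2) := by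
      intro i hi hij
      rw [hdu _ (by omega), Function.update_of_ne (by omega)]
    have hstep : C.Step m f r g := by
      refine Or.inr ⟨⟨by omega, hfl r (by simp), (hce r (by simp)).1, (hce r (by simp)).2,
        hg0, hg1⟩, fun i hi => ?_, j, hj, hgj⟩
      rcases hslot i hi with h0 | ⟨h1, h2, h3⟩
      · exact Or.inl h0
      · by_cases hij : i = j
        · subst hij
          rcases hfree with h0 | hfree
          · exact Or.inl h0
          · exact Or.inr ⟨h3 r (by simp), hind _ h1 _ hrS (fun he => h2 (by rw [he]; simp)),
              Or.inr hfree⟩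
        · exact Or.inr ⟨h3 r (by simp), hind _ h1 _ hrS (fun he => h2 (by rw [he]; simp)),
            Or.inl (hgi i hi hij)⟩
    have hnr : ∀ i < m, f (i + 2) ≠ r := fun i hi he => by
      rcases hslot i hi with h0 | ⟨-, h2, -⟩
      · omega
      · exact h2 (by rw [he]; simp)
    obtain ⟨t', ht', h1, hval⟩ := ih (fun s hs => hS s (by simp [hs])) hsort.2 hnd.2 u hu
      (fun s hs => by rw [← hg, hg0]; exact hfl s (by simp [hs]))
      (fun s hs => by rw [← hg, hg1]; exact hce s (by simp [hs]))
      (fun i hi => by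
        rw [← hg]
        by_cases hij : i = j
        · rw [hij, hgj]
          exact Or.inr ⟨hrS, hnd.1, hsort.1⟩
        · rw [hgi i hi hij]
          refine (hslot i hi).imp id fun ⟨h1, h2, h3⟩ => ⟨h1, fun hm => h2 (by simp [hm]),
            fun s hs => h3 s (by simp [hs])⟩)
      (fun i hi i' hi' he hne => by
        rw [← hg] at he hne
        by_cases hij : i = j <;> by_cases hij' : i' = j
        · omega
        · rw [hij, hgj, hgi i' hi' hij'] at he
          exact absurd he.symm (hnr i' hi')
        · rw [hij', hgj, hgi i hi hij] at he
          exact absurd he (hnr i hi)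
        · rw [hgi i hi hij] at he hne
          rw [hgi i' hi' hij'] at he
          exact hinj i hi i' hi' he hne)
    refine ⟨t', ht', h1.trans hg1, fun l hl => ?_⟩
    simp only [List.length_cons] at hl
    have h2 := hval l (by omega)
    have h3 := h.step (l + todo.length) (by omega) t ht r (hN r hrS) u hu hstep
    simp only [List.map_cons, List.sum_cons, List.length_cons]
    rw [← add_assoc]
    linarith

/-- A set of independent labels that splits into vertically separated slabs `q = const`, in each of
which no vertical line meets more than `m` labels, is the set of labels of a walk. -/
theorem Dominates.slabs {m N L : ℕ} {val : ℕ → ℕ → ℝ} (h : Dominates C m N L val)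
    (hwt : C.wt 0 = 0) (q : ℕ → ℤ)
    (S : Finset ℕ) (hpos : ∀ r ∈ S, 1 ≤ r) (hN : ∀ r ∈ S, r ≤ N)
    (hlt : ∀ r ∈ S, C.lx r < C.rx r)
    (hind : ∀ s ∈ S, ∀ r ∈ S, s ≠ r → C.Indep s r)
    (hsep : ∀ s ∈ S, ∀ r ∈ S, q s < q r → C.ly s + 1 < C.ly r)
    (hdens : ∀ r ∈ S,
      (S.filter fun s => q s = q r ∧ C.lx s ≤ C.lx r ∧ C.lx r ≤ C.rx s).card ≤ m)
    (t : ℕ) (ht : t < (N + 1) ^ (m + 2))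
    (hfl : ∀ r ∈ S, dig (N + 1) t 1 = 0 ∨ C.ly (dig (N + 1) t 1) + 1 < C.ly r)
    (hL : 2 * S.card ≤ L) : ∑ r ∈ S, C.wt r ≤ val (2 * S.card) t := by
  induction hk : S.card using Nat.strong_induction_on generalizing S t with
  | _ k ih =>
  subst hk
  rcases S.eq_empty_or_nonempty with rfl | hne
  · simpa using h.nonneg t ht
  obtain ⟨r₀, hr₀, hmin⟩ := S.exists_min_image q hne
  set S₀ := S.filter fun s => q s = q r₀ with hS₀
  set S₁ := S.filter fun s => ¬ q s = q r₀ with hS₁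
  have hsub₀ : ∀ s ∈ S₀, s ∈ S := fun s hs => (Finset.mem_filter.1 hs).1
  have hsub₁ : ∀ s ∈ S₁, s ∈ S := fun s hs => (Finset.mem_filter.1 hs).1
  have hcard : S₀.card + S₁.card = S.card := Finset.card_filter_add_card_filter_not _
  have hmem₀ : r₀ ∈ S₀ := Finset.mem_filter.2 ⟨hr₀, rfl⟩
  have hpos₀ : 0 < S₀.card := Finset.card_pos.2 ⟨r₀, hmem₀⟩
  -- The lowest slab is opened with its highest label as the ceiling.
  obtain ⟨u, hu, hmax⟩ := S₀.exists_max_image C.ly ⟨r₀, hmem₀⟩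
  have huS := hsub₀ u hu
  obtain ⟨t₁, ht₁, hd⟩ := exists_dig (b := N + 1) (m + 2)
    (fun i => if i = 0 then dig (N + 1) t 1 else if i = 1 then u else 0) (by
      intro i _
      have h1 : dig (N + 1) t 1 < N + 1 := Nat.mod_lt _ (by omega)
      have := hN u huS
      split_ifs <;> omega)
  have hd0 : dig (N + 1) t₁ 0 = dig (N + 1) t 1 := by simp [hd]
  have hd1 : dig (N + 1) t₁ 1 = u := by simp [hd]
  have hdi : ∀ i < m, dig (N + 1) t₁ (i + 2) = 0 := fun i hi => by
    rw [hd _ (by omega)]; simp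
  have hstep : C.Step m (dig (N + 1) t) 0 (dig (N + 1) t₁) := by
    refine Or.inl ⟨rfl, hd0, ?_, hdi⟩
    rw [hd1]
    refine (hfl u huS).imp id fun h1 => ⟨by have := hpos u huS; omega, by linarith⟩
  let R : ℕ → ℕ → Prop := fun s r => C.lx s ≤ C.lx r
  have : Std.Total R := ⟨fun a b => le_total (C.lx a) (C.lx b)⟩
  have : IsTrans ℕ R := ⟨fun a b c => le_trans⟩
  classical
  let todo := S₀.toList.insertionSort R
  have hperm : todo.Perm S₀.toList := List.perm_insertionSort R _
  have hmem : ∀ r ∈ todo, r ∈ S₀ := fun r hr => by simpa using hperm.mem_iff.1 hr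
  have hlen : todo.length = S₀.card := by simpa using hperm.length_eq
  have hsum : (todo.map C.wt).sum = ∑ r ∈ S₀, C.wt r := by
    rw [(hperm.map C.wt).sum_eq, Finset.sum_map_toList]
  obtain ⟨t₂, ht₂, hd2, hval⟩ := h.slab S₀ (fun r hr => hpos r (hsub₀ r hr))
    (fun r hr => hN r (hsub₀ r hr)) (fun r hr => hlt r (hsub₀ r hr))
    (fun s hs r hr => hind s (hsub₀ s hs) r (hsub₀ r hr))
    (fun r hr => by
      have := hdens r (hsub₀ r hr)
      rwa [hS₀, Finset.filter_filter, ← (Finset.mem_filter.1 hr).2])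
    todo hmem (List.pairwise_insertionSort R _) (hperm.nodup_iff.2 S₀.nodup_toList) t₁ ht₁
    (fun r hr => by rw [hd0]; exact hfl r (hsub₀ r (hmem r hr)))
    (fun r hr => by
      rw [hd1]
      exact ⟨by have := hpos u huS; omega, hmax r (hmem r hr)⟩)
    (fun i hi => Or.inl (hdi i hi)) (fun i hi j hj _ hne => absurd (hdi i hi) hne)
  have hlt₁ : ∀ r ∈ S₁, q r₀ < q r := fun r hr =>
    lt_of_le_of_ne (hmin r (hsub₁ r hr)) (Ne.symm (Finset.mem_filter.1 hr).2)
  have hrest := ih S₁.card (by omega) S₁ (fun r hr => hpos r (hsub₁ r hr))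
    (fun r hr => hN r (hsub₁ r hr)) (fun r hr => hlt r (hsub₁ r hr))
    (fun s hs r hr => hind s (hsub₁ s hs) r (hsub₁ r hr))
    (fun s hs r hr => hsep s (hsub₁ s hs) r (hsub₁ r hr))
    (fun r hr => (Finset.card_le_card (Finset.filter_subset_filter _
      (Finset.filter_subset _ _))).trans (hdens r (hsub₁ r hr)))
    t₂ ht₂ (fun r hr => by
      rw [hd2, hd1]
      refine Or.inr (hsep u huS r (hsub₁ r hr) ?_)
      rw [(Finset.mem_filter.1 hu).2]
      exact hlt₁ r hr) (by omega) rfl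
  have h1 := hval (2 * S₁.card) (by omega)
  have h2 := h.step (2 * S₁.card + todo.length) (by omega) t ht 0 (by omega) t₁ ht₁ hstep
  have h3 := h.mono_le (l := 2 * S₁.card + todo.length + 1) (l' := 2 * S.card) (by omega) hL ht
  rw [← Finset.sum_filter_add_sum_filter_not S (fun s => q s = q r₀) C.wt, ← hsum]
  rw [hwt] at h2
  linarith

/-- The shifting argument: for every `M ≥ 1`, deleting the labels `s` with `⌈ly s⌉` in the lightest
residue class modulo `M` costs at most the fraction `1 / M` of the weight.  The other labels form
slabs as in `Dominates.slabs`.  At most two labels of a slab with the same value of `⌈ly s⌉` can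
meet a vertical line, since they overlap vertically; so at most `2 * M` labels of the slab meet the
line. -/
theorem Dominates.one_sub_mul_le {m N L M : ℕ} {val : ℕ → ℕ → ℝ} (h : Dominates C m N L val)
    (hC : C.Proper N) (hM : 1 ≤ M) (hm : m = 2 * M) (hL : L = 2 * N)
    (S : Finset ℕ) (hpos : ∀ r ∈ S, 1 ≤ r) (hN : ∀ r ∈ S, r ≤ N)
    (hind : ∀ s ∈ S, ∀ r ∈ S, s ≠ r → C.Indep s r) :
    (1 - 1 / (M : ℝ)) * ∑ r ∈ S, C.wt r ≤ val L 0 := by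
  have hM0 : (0 : ℤ) < M := by exact_mod_cast hM
  have hMR : (0 : ℝ) < M := by exact_mod_cast hM
  -- The residue class `c` is the lightest one.
  obtain ⟨c, hc, hlight⟩ : ∃ c ∈ Finset.Ico (0 : ℤ) M,
      ∑ r ∈ S with ⌈C.ly r⌉ % (M : ℤ) = c, C.wt r ≤ (∑ r ∈ S, C.wt r) / M := by
    apply Finset.exists_le_of_sum_le ⟨0, by simpa using hM0⟩
    rw [Finset.sum_fiberwise_of_maps_to (fun r _ => Finset.mem_Ico.2
      ⟨Int.emod_nonneg _ hM0.ne', Int.emod_lt_of_pos _ hM0⟩)]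
    simp only [Finset.sum_const, Int.card_Ico, sub_zero, Int.toNat_natCast, nsmul_eq_mul]
    rw [mul_div_cancel₀ _ hMR.ne']
  set S' := S.filter fun r => ¬ ⌈C.ly r⌉ % (M : ℤ) = c with hS'
  have hsub : ∀ s ∈ S', s ∈ S := fun s hs => (Finset.mem_filter.1 hs).1
  have hcard : S'.card ≤ N := by
    have : S' ⊆ Finset.Icc 1 N := fun s hs =>
      Finset.mem_Icc.2 ⟨hpos s (hsub s hs), hN s (hsub s hs)⟩
    simpa using Finset.card_le_card this
  have hc := Finset.mem_Ico.1 hc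
  have hslabs := h.slabs hC.wt_zero (fun r => (⌈C.ly r⌉ - c) / M) S'
    (fun r hr => hpos r (hsub r hr)) (fun r hr => hN r (hsub r hr))
    (fun r hr => hC.lt r (hpos r (hsub r hr)) (hN r (hsub r hr)))
    (fun s hs r hr => hind s (hsub s hs) r (hsub r hr)) ?_ ?_ 0 (by positivity)
    (fun r _ => Or.inl (dig_zero _ _)) (by omega)
  · have h1 := h.mono_le (l := 2 * S'.card) (l' := L) (by omega) le_rfl (t := 0) (by positivity)
    have h2 := Finset.sum_filter_add_sum_filter_not S (fun r => ⌈C.ly r⌉ % (M : ℤ) = c) C.wt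
    rw [← hS'] at h2
    have h3 : (1 - 1 / (M : ℝ)) * ∑ r ∈ S, C.wt r = ∑ r ∈ S, C.wt r - (∑ r ∈ S, C.wt r) / M := by
      ring
    linarith
  -- The residue `c` does not occur, so the values of `⌈ly s⌉` in different slabs differ by at least 2.
  · intro s hs r hr hlt
    have hr' : (⌈C.ly r⌉ - c) % M ≠ 0 := by
      intro h0
      apply (Finset.mem_filter.1 hr).2
      rw [Int.emod_eq_emod_iff_emod_sub_eq_zero.2 h0, Int.emod_eq_of_lt hc.1 hc.2]
    have h1 := Int.emod_add_mul_ediv (⌈C.ly r⌉ - c) M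
    have h2 := Int.emod_add_mul_ediv (⌈C.ly s⌉ - c) M
    have h3 := Int.emod_nonneg (⌈C.ly r⌉ - c) hM0.ne'
    have h4 := Int.emod_lt_of_pos (⌈C.ly s⌉ - c) hM0
    have h5 : (M : ℤ) * ((⌈C.ly s⌉ - c) / M) + M ≤ M * ((⌈C.ly r⌉ - c) / M) := by
      have := Int.add_one_le_of_lt hlt
      nlinarith
    have h6 : ⌈C.ly s⌉ + 2 ≤ ⌈C.ly r⌉ := by omega
    have h7 := Int.le_ceil (C.ly s)
    have h8 := Int.ceil_lt_add_one (C.ly r)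
    have h9 : (⌈C.ly s⌉ : ℝ) + 2 ≤ ⌈C.ly r⌉ := by exact_mod_cast h6
    linarith
  · intro r hr
    have hcard : ((Finset.Ico (0 : ℤ) M) ×ˢ (Finset.univ : Finset Bool)).card = m := by
      simp [Finset.card_product, hm, mul_comm]
    rw [← hcard]
    -- Within a slab the residue of `⌈ly s⌉` determines `⌈ly s⌉`.  Of two independent labels with the
    -- same value of `⌈ly s⌉` one ends before the other begins; if both meet the line through the
    -- left edge of `r`, the first one ends on that line and the other one does not.
    refine Finset.card_le_card_of_injOn
      (fun s => ((⌈C.ly s⌉ - c) % M, decide (C.rx s = C.lx r))) ?_ ?_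
    · intro s _
      simp [Int.emod_nonneg _ hM0.ne', Int.emod_lt_of_pos _ hM0, em]
    · intro s hs s' hs' he
      obtain ⟨hs1, hs2, hs3, hs4⟩ := Finset.mem_filter.1 hs
      obtain ⟨hs1', hs2', hs3', hs4'⟩ := Finset.mem_filter.1 hs'
      have hs1 := hsub s hs1
      have hs1' := hsub s' hs1'
      simp only [Prod.mk.injEq] at he
      obtain ⟨he1, he2⟩ := he
      have hiff : C.rx s = C.lx r ↔ C.rx s' = C.lx r := by simpa using he2
      have hceil : ⌈C.ly s⌉ = ⌈C.ly s'⌉ := by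
        have h1 := Int.emod_add_mul_ediv (⌈C.ly s⌉ - c) M
        have h2 := Int.emod_add_mul_ediv (⌈C.ly s'⌉ - c) M
        rw [hs2, ← hs2', he1] at h1
        omega
      have hR : (⌈C.ly s⌉ : ℝ) = ⌈C.ly s'⌉ := by exact_mod_cast hceil
      have h1 := Int.le_ceil (C.ly s)
      have h2 := Int.ceil_lt_add_one (C.ly s)
      have h3 := Int.le_ceil (C.ly s')
      have h4 := Int.ceil_lt_add_one (C.ly s')
      have hl := hC.lt s (hpos s hs1) (hN s hs1)
      have hl' := hC.lt s' (hpos s' hs1') (hN s' hs1')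
      by_contra hne
      rcases (hind s hs1 s' hs1' hne).2 with h5 | h5 | h5 | h5
      · have := hiff.1 (by linarith)
        linarith
      · have := hiff.2 (by linarith)
        linarith
      · linarith
      · linarith

end Cands

end Labeling4M

/-! ### Memory layout -/

namespace Labeling4M

open RealRAM

/-- Sequential composition of programs. -/
infixr:60 " ;; " => RealRAM.Program.seq

-- Natural arrays of the input and output: the number of points, the numbers of anchor points, and
-- the flags of the labeled points.
notation "nPts" => 0
notation "nCnt" => 1
notation "nOut" => 2

-- Natural arrays of the algorithm: the points of the candidates, the digits of the states, and the
-- tables of the first steps of heaviest walks, namely the next states and the labels.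
notation "nPt" => 3
notation "nDig" => 4
notation "nSucc" => 5
notation "nLab" => 6

-- Natural variables, kept at index `0` of arrays of their own, for the number of candidates, the
-- number of slots, the number of digits of a state, the base of the digits, and the number of states.
notation "vN" => 7
notation "vM" => 11
notation "vD" => 12
notation "vB" => 13
notation "vS" => 14

-- A step of the dynamic program: from the state `vT`, whose digits start at the address `vRowT`,
-- with the label `vR` to the state `vU`, whose digits start at `vRowU`.
notation "vT" => 18
notation "vRowT" => 16
notation "vR" => 19
notation "vU" => 20
notation "vRowU" => 17

-- The number of levels of the tables, the current level, and the addresses at which the previous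
-- and the current level start.
notation "vL" => 28
notation "vLev" => 29
notation "vLo" => 26
notation "vHi" => 27

-- Counters and temporary values.
notation "vI" => 8
notation "vJ" => 9
notation "vK" => 21
notation "vY" => 10
notation "vA" => 15
notation "vCarry" => 32
notation "vF" => 30
notation "vG" => 31

-- Flags for the test of a step.
notation "vClear" => 24
notation "vOk" => 22
notation "vFound" => 23
notation "vEdge" => 25

-- Real arrays of the input and output: the coordinates of the points, the lengths, the weights, the
-- coordinates of the anchor points, `ε`, and the coordinates of the labels.
notation "rPx" => 0
notation "rPy" => 1
notation "rLen" => 2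
notation "rW" => 3
notation "rAx" => 4
notation "rAy" => 5
notation "rEps" => 6
notation "rOutX" => 7
notation "rOutY" => 8

-- Real arrays of the algorithm: the left, lower and right edges and the weights of the candidates,
-- and the table of the weights of heaviest walks.
notation "rLx" => 9
notation "rLy" => 10
notation "rRx" => 11
notation "rWt" => 12
notation "rVal" => 13

-- A real variable: the multiples of `ε`.
notation "rX" => 14

/-! ### Collecting the candidates -/

/-- The program that lists the candidates: one for each point and each of its anchor points. -/
def collect : Program :=
  .forTo vI nPts (
    .assignNat vY (.lit 0) (.read nCnt (.var vI)) ;;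
    .forTo vJ vY (
      .assignNat vN (.lit 0) (.add (.var vN) (.lit 1)) ;;
      .assignNat nPt (.var vN) (.var vI) ;;
      .assignReal rLx (.var vN)
        (.sub (.read rPx (.var vI)) (.read rAx (.sub (.var vN) (.lit 1)))) ;;
      .assignReal rLy (.var vN)
        (.sub (.read rPy (.var vI)) (.read rAy (.sub (.var vN) (.lit 1)))) ;;
      .assignReal rRx (.var vN) (.add (.read rLx (.var vN)) (.read rLen (.var vI))) ;;
      .assignReal rWt (.var vN) (.read rW (.var vI))))

/-- The candidate list that is stored in a memory state. -/
def candsOf (s : State) : Cands where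
  pt := s.nat nPt
  lx := s.real rLx
  rx := s.real rRx
  ly := s.real rLy
  wt := s.real rWt

variable (I : Instance)

/-- Candidate `r` is the label of the point `i` that has its anchor point `a` at that point. -/
def IsCand (C : Cands) (r : ℕ) (i : Fin I.n) (a : ℝ × ℝ) : Prop :=
  C.pt r = i ∧ C.lx r = (I.point i).1 - a.1 ∧ C.ly r = (I.point i).2 - a.2 ∧
    C.rx r = (I.point i).1 - a.1 + I.length i ∧ C.wt r = I.weight i

/-- The candidates `1, …, N` are exactly the pairs of a point and one of its anchor points. -/
structure Lists (C : Cands) (N : ℕ) : Prop where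
  sound : ∀ r, 1 ≤ r → r ≤ N → ∃ i, ∃ a ∈ I.anchors i, IsCand I C r i a
  complete : ∀ i, ∀ a ∈ I.anchors i, ∃ r, 1 ≤ r ∧ r ≤ N ∧ IsCand I C r i a
  wt_zero : C.wt 0 = 0

variable {I}

theorem arrayOf_ofFn {α : Type} [Zero α] {n : ℕ} (f : Fin n → α) (i : Fin n) :
    Instance.arrayOf (List.ofFn f) i = f i := by
  simp [Instance.arrayOf]

/-- The anchor points of the first `i` points. -/
def anchorsBefore (I : Instance) (i : ℕ) : List (ℝ × ℝ) := ((List.ofFn I.anchors).take i).flatten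

theorem anchorsBefore_succ (i : Fin I.n) :
    anchorsBefore I (i + 1) = anchorsBefore I i ++ I.anchors i := by
  simp [anchorsBefore, List.take_add_one]

theorem anchorsBefore_n : anchorsBefore I I.n = I.allAnchors := by
  simp [anchorsBefore, Instance.allAnchors, List.take_of_length_le]

theorem allAnchors_length : I.allAnchors.length = ∑ i, (I.anchors i).length := by
  simp [Instance.allAnchors, List.length_flatten, List.map_ofFn, List.sum_ofFn]

theorem getElem?_allAnchors (i : Fin I.n) (j : ℕ) (hj : j < (I.anchors i).length) :
    I.allAnchors[(anchorsBefore I i).length + j]? = some (I.anchors i)[j] := by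
  have h : I.allAnchors = anchorsBefore I (i + 1) ++
      ((List.ofFn I.anchors).drop (i + 1)).flatten := by
    rw [anchorsBefore, ← List.flatten_append, List.take_append_drop, Instance.allAnchors]
  rw [h, anchorsBefore_succ, List.append_assoc, List.getElem?_append_right (by omega)]
  simp [List.getElem?_append_left, hj]

theorem arrayOf_allAnchors (g : ℝ × ℝ → ℝ) (i : Fin I.n) (j : ℕ)
    (hj : j < (I.anchors i).length) :
    Instance.arrayOf (I.allAnchors.map g) ((anchorsBefore I i).length + j) =
      g (I.anchors i)[j] := by
  simp [Instance.arrayOf, getElem?_allAnchors i j hj]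

theorem IsCand.congr {C C' : Cands} {r : ℕ} {i : Fin I.n} {a : ℝ × ℝ} (h : IsCand I C r i a)
    (h1 : C'.pt r = C.pt r) (h2 : C'.lx r = C.lx r) (h3 : C'.ly r = C.ly r)
    (h4 : C'.rx r = C.rx r) (h5 : C'.wt r = C.wt r) : IsCand I C' r i a := by
  unfold IsCand
  rw [h1, h2, h3, h4, h5]
  exact h

/-- The state of the program `collect` after `j` anchor points of the point `i`. -/
structure Collected (I : Instance) (i j : ℕ) (s : State) : Prop where
  num : s.nat vN 0 = (anchorsBefore I i).length + j
  sound : ∀ r, 1 ≤ r → r ≤ s.nat vN 0 → ∃ i, ∃ a ∈ I.anchors i, IsCand I (candsOf s) r i a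
  before : ∀ i' : Fin I.n, (i' : ℕ) < i → ∀ a ∈ I.anchors i', ∃ r, 1 ≤ r ∧ r ≤ s.nat vN 0 ∧
    IsCand I (candsOf s) r i' a
  current : ∀ i' : Fin I.n, (i' : ℕ) = i → ∀ j' < j, ∀ a, (I.anchors i')[j']? = some a →
    ∃ r, 1 ≤ r ∧ r ≤ s.nat vN 0 ∧ IsCand I (candsOf s) r i' a
  wt_zero : s.real rWt 0 = 0

theorem runs_collect {Z : ℕ} {ε : ℝ} (hZ : I.size ≤ Z) :
    Runs Z collect (I.input ε) fun s => s.nat vN 0 = I.allAnchors.length ∧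
      Lists I (candsOf s) I.allAnchors.length := by
  have hn : I.n ≤ Z := by unfold Instance.size at hZ; omega
  have hcnt : ∀ i, (I.anchors i).length ≤ Z := fun i => by
    have := Finset.single_le_sum (f := fun i => (I.anchors i).length) (fun _ _ => Nat.zero_le _)
      (Finset.mem_univ i)
    simp only [Instance.size] at hZ
    omega
  refine Runs.forTo I.n (by simp [Instance.input, Instance.arrayOf]) hn rfl rfl (by decide)
    (fun i s => Collected I i 0 s) ?_ ?_ ?_
  · constructor
    · simp [Instance.input, anchorsBefore]
    · intro r hr hr'
      simp [Instance.input] at hr'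
      omega
    · intro i' hi'
      omega
    · intro i' hi' j' hj'
      omega
    · simp [Instance.input]
  · intro i hi s hs hvi hf
    refine Runs.assignNat_seq ?_
    have hy : s.nat nCnt i = (I.anchors ⟨i, hi⟩).length := by
      rw [hf.1 nCnt rfl]
      exact arrayOf_ofFn (fun i => (I.anchors i).length) ⟨i, hi⟩
    simp only [NExpr.eval, hvi, hy]
    refine Runs.forTo (I.anchors ⟨i, hi⟩).length (by simp) (hcnt _) rfl rfl (by decide)
      (fun j s => Collected I i j s) ?_ ?_ ?_
    · constructor
      · simpa using hs.num
      · simpa [candsOf] using hs.sound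
      · simpa [candsOf] using hs.before
      · intro i' hi' j' hj'
        omega
      · simpa using hs.wt_zero
    · intro j hj s₁ hs₁ hvj hf₁
      have hvi₁ : s₁.nat vI 0 = i := by rw [hf₁.1 vI rfl]; simpa using hvi
      have hax : s₁.real rAx (s₁.nat vN 0) = (I.anchors ⟨i, hi⟩)[j].1 := by
        rw [hf₁.2 rAx rfl, State.setNat_real, hf.2 rAx rfl, hs₁.num]
        exact arrayOf_allAnchors Prod.fst ⟨i, hi⟩ j hj
      have hay : s₁.real rAy (s₁.nat vN 0) = (I.anchors ⟨i, hi⟩)[j].2 := by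
        rw [hf₁.2 rAy rfl, State.setNat_real, hf.2 rAy rfl, hs₁.num]
        exact arrayOf_allAnchors Prod.snd ⟨i, hi⟩ j hj
      have hpx : s₁.real rPx i = (I.point ⟨i, hi⟩).1 := by
        rw [hf₁.2 rPx rfl, State.setNat_real, hf.2 rPx rfl]
        exact arrayOf_ofFn (fun i => (I.point i).1) ⟨i, hi⟩
      have hpy : s₁.real rPy i = (I.point ⟨i, hi⟩).2 := by
        rw [hf₁.2 rPy rfl, State.setNat_real, hf.2 rPy rfl]
        exact arrayOf_ofFn (fun i => (I.point i).2) ⟨i, hi⟩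
      have hlen : s₁.real rLen i = I.length ⟨i, hi⟩ := by
        rw [hf₁.2 rLen rfl, State.setNat_real, hf.2 rLen rfl]
        exact arrayOf_ofFn I.length ⟨i, hi⟩
      have hw : s₁.real rW i = I.weight ⟨i, hi⟩ := by
        rw [hf₁.2 rW rfl, State.setNat_real, hf.2 rW rfl]
        exact arrayOf_ofFn I.weight ⟨i, hi⟩
      refine Runs.assignNat_seq (Runs.assignNat_seq (Runs.assignReal_seq (Runs.assignReal_seq
        (Runs.assignReal_seq (Runs.assignReal ?_)))))
      generalize hs₂ : State.setNat _ vJ 0 (j + 1) = s₂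
      have hnum : s₂.nat vN 0 = s₁.nat vN 0 + 1 := by simp [← hs₂]
      have hnew : IsCand I (candsOf s₂) (s₁.nat vN 0 + 1) ⟨i, hi⟩ (I.anchors ⟨i, hi⟩)[j] := by
        simp [IsCand, ← hs₂, candsOf, hvi₁, hax, hay, hpx, hpy, hlen, hw]
      have hold : ∀ r ≤ s₁.nat vN 0, ∀ i a, IsCand I (candsOf s₁) r i a →
          IsCand I (candsOf s₂) r i a := by
        intro r hr i a h
        have hne : r ≠ s₁.nat vN 0 + 1 := by omega
        refine h.congr ?_ ?_ ?_ ?_ ?_ <;> simp [← hs₂, candsOf, hne]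
      constructor
      · rw [hnum, hs₁.num, add_assoc]
      · intro r hr hr'
        rw [hnum] at hr'
        rcases Nat.lt_or_ge (s₁.nat vN 0) r with h | h
        · obtain rfl : r = s₁.nat vN 0 + 1 := by omega
          exact ⟨⟨i, hi⟩, _, List.getElem_mem hj, hnew⟩
        · obtain ⟨i', a, ha, h'⟩ := hs₁.sound r hr h
          exact ⟨i', a, ha, hold r h i' a h'⟩
      · intro i' hi' a ha
        obtain ⟨r, hr, hr', h⟩ := hs₁.before i' hi' a ha
        exact ⟨r, hr, by omega, hold r hr' i' a h⟩
      · intro i' hi' j' hj' a ha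
        rcases Nat.lt_or_ge j' j with h | h
        · obtain ⟨r, hr, hr', h⟩ := hs₁.current i' hi' j' h a ha
          exact ⟨r, hr, by omega, hold r hr' i' a h⟩
        · obtain rfl : j' = j := by omega
          subst hi'
          rw [List.getElem?_eq_getElem hj, Option.some_inj] at ha
          exact ⟨_, by omega, hnum.ge, ha ▸ hnew⟩
      · simpa [← hs₂] using hs₁.wt_zero
    · intro s₁ hs₁ _
      have hnum : s₁.nat vN 0 = (anchorsBefore I (i + 1)).length := by
        rw [hs₁.num, anchorsBefore_succ ⟨i, hi⟩, List.length_append]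
      constructor
      · simpa using hnum
      · simpa [candsOf] using hs₁.sound
      · intro i' hi' a ha
        rcases Nat.lt_or_ge i' i with h | h
        · simpa [candsOf] using hs₁.before i' h a ha
        · obtain rfl : (i' : ℕ) = i := by omega
          obtain ⟨j', hj', rfl⟩ := List.getElem_of_mem ha
          simpa [candsOf] using hs₁.current i' rfl j' hj' _ (List.getElem?_eq_getElem hj')
      · intro i' hi' j' hj'
        omega
      · simpa using hs₁.wt_zero
  · intro s hs _
    have hnum : s.nat vN 0 = I.allAnchors.length := by simpa [anchorsBefore_n] using hs.num
    rw [← hnum]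
    exact ⟨rfl, hs.sound, fun i a ha => hs.before i i.2 a ha, hs.wt_zero⟩

/-! ### Parameters and the table of digits -/

/-- The program that computes the number `vM = 2 * M` of slots, where `M` is the least positive
integer with `1 ≤ M * ε`, the number `vD` of digits of a state, the base `vB`, and the number
`vS = vB ^ vD` of states. -/
def setParameters : Program :=
  .assignReal rX (.lit 0) (.var rEps) ;;
  .assignNat vM (.lit 0) (.lit 2) ;;
  .loop (.neg (.realLe (.lit 1) (.var rX)))
    (.assignReal rX (.lit 0) (.add (.var rX) (.var rEps)) ;;
      .assignNat vM (.lit 0) (.add (.var vM) (.lit 2))) ;;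
  .assignNat vD (.lit 0) (.add (.var vM) (.lit 2)) ;;
  .assignNat vB (.lit 0) (.add (.var vN) (.lit 1)) ;;
  .assignNat vS (.lit 0) (.lit 1) ;;
  .forTo vI vD (
    .assignNat vA (.lit 0) (.lit 0) ;;
    .forTo vJ vB (.assignNat vA (.lit 0) (.add (.var vA) (.var vS))) ;;
    .assignNat vS (.lit 0) (.var vA))

theorem runs_setParameters {Z : ℕ} {s : State} {ε : ℝ} {N M : ℕ} (hε : s.real rEps 0 = ε)
    (hM : 1 ≤ M) (hMε : 1 ≤ M * ε) (hmin : ∀ i : ℕ, i < M → i * ε < 1) (hN : s.nat vN 0 = N)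
    (hMZ : M ≤ Z) (hDZ : 2 * M + 2 ≤ Z) (hNZ : N + 1 ≤ Z) :
    Runs Z setParameters s fun s' => s'.nat vM 0 = 2 * M ∧ s'.nat vD 0 = 2 * M + 2 ∧
      s'.nat vB 0 = N + 1 ∧ s'.nat vS 0 = (N + 1) ^ (2 * M + 2) := by
  refine Runs.assignReal_seq (Runs.assignNat_seq (Runs.seq (R := fun s' =>
    s'.nat vM 0 = 2 * M ∧ s'.nat vN 0 = N) ?_ ?_))
  · refine Runs.loop (n := M - 1) (by omega) (fun i s' => s'.real rX 0 = (i + 1 : ℕ) * ε ∧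
      s'.real rEps 0 = ε ∧ s'.nat vM 0 = 2 * (i + 1) ∧ s'.nat vN 0 = N) ?_ ?_ ?_ ?_
    · simp [hε, hN]
    · rintro i hi s' ⟨h1, h2, h3, h4⟩
      constructor
      · have := hmin (i + 1) (by omega)
        simpa [h1] using this
      · refine Runs.assignReal_seq (Runs.assignNat ?_)
        simp [h1, h2, h3, h4]
        constructor
        · ring
        · ring
    · rintro s' ⟨h1, h2, h3, h4⟩
      rw [Nat.sub_add_cancel hM] at h1
      simpa [h1] using hMε
    · rintro s' ⟨h1, h2, h3, h4⟩
      exact ⟨by omega, h4⟩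
  · rintro s₁ ⟨h1, h2⟩ -
    refine Runs.assignNat_seq (Runs.assignNat_seq (Runs.assignNat_seq ?_))
    refine Runs.forTo (2 * M + 2) (by simp [h1]) hDZ rfl rfl (by decide)
      (fun i s' => s'.nat vS 0 = (N + 1) ^ i) (by simp) ?_ ?_
    · intro i hi s₂ hs₂ _ hf
      have hb : s₂.nat vB 0 = N + 1 := by rw [hf.1 vB rfl]; simp [h2]
      refine Runs.assignNat_seq (Runs.seq (R := fun s' => s'.nat vA 0 = (N + 1) * (N + 1) ^ i)
        ?_ ?_)
      · refine Runs.forTo (N + 1) (by simp [hb]) hNZ rfl rfl (by decide)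
          (fun j s' => s'.nat vA 0 = j * (N + 1) ^ i) (by simp) ?_ ?_
        · intro j _ s₃ hs₃ _ hf₃
          have hS : s₃.nat vS 0 = (N + 1) ^ i := by rw [hf₃.1 vS rfl]; simpa using hs₂
          refine Runs.assignNat ?_
          simp [hs₃, hS]
          ring
        · intro s₃ hs₃ _
          exact hs₃
      · intro s₃ hs₃ _
        refine Runs.assignNat ?_
        simp [hs₃]
        ring
    · intro s₂ hs₂ hf
      refine ⟨?_, ?_, ?_, hs₂⟩
      · rw [hf.1 vM rfl]; simp [h1]
      · rw [hf.1 vD rfl]; simp [h1]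
      · rw [hf.1 vB rfl]; simp [h2]

/-- The program that writes the digits of all states: the digits of `t` are the entries of `nDig`
from index `vD * t` on.  The next row results from adding `1` with carry. -/
def fillDigits : Program :=
  .assignNat vRowT (.lit 0) (.lit 0) ;;
  .forTo vT vS (
    .assignNat vCarry (.lit 0) (.lit 1) ;;
    .forTo vI vD (
      .assignNat vA (.lit 0)
        (.add (.read nDig (.add (.var vRowT) (.var vI))) (.var vCarry)) ;;
      .branch (.natLe (.var vB) (.var vA))
        (.assignNat nDig (.add (.add (.var vRowT) (.var vD)) (.var vI)) (.lit 0))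
        (.assignNat nDig (.add (.add (.var vRowT) (.var vD)) (.var vI)) (.var vA) ;;
          .assignNat vCarry (.lit 0) (.lit 0))) ;;
    .assignNat vRowT (.lit 0) (.add (.var vRowT) (.var vD)))

/-- Adding `1` to a number: the digit with index `i` changes if and only if all lower digits of the
result are zero. -/
theorem dig_succ {b : ℕ} (hb : 0 < b) (t i : ℕ) :
    (b ≤ Cands.dig b t i + (if b ^ i ∣ t + 1 then 1 else 0) →
      Cands.dig b (t + 1) i = 0 ∧ b ^ (i + 1) ∣ t + 1 ∧ b ^ i ∣ t + 1) ∧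
    (¬ b ≤ Cands.dig b t i + (if b ^ i ∣ t + 1 then 1 else 0) →
      Cands.dig b (t + 1) i = Cands.dig b t i + (if b ^ i ∣ t + 1 then 1 else 0) ∧
        ¬ b ^ (i + 1) ∣ t + 1) := by
  have hlt : Cands.dig b t i < b := Nat.mod_lt _ hb
  by_cases hd : b ^ i ∣ t + 1
  · have h1 : (t + 1) / b ^ i = t / b ^ i + 1 := by rw [Nat.succ_div, if_pos hd]
    have h2 : b ^ (i + 1) ∣ t + 1 ↔ b ∣ (t + 1) / b ^ i := by
      rw [pow_succ, Nat.dvd_div_iff_mul_dvd hd]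
    rw [if_pos hd]
    simp only [Cands.dig] at hlt ⊢
    rw [h2, h1, Nat.dvd_iff_mod_eq_zero, ← Nat.mod_add_mod]
    constructor
    · intro h
      have : t / b ^ i % b + 1 = b := by omega
      simp [this, hd]
    · intro h
      rw [Nat.mod_eq_of_lt (by omega)]
      omega
  · have h1 : (t + 1) / b ^ i = t / b ^ i := by rw [Nat.succ_div, if_neg hd, add_zero]
    rw [if_neg hd]
    refine ⟨fun h => by omega, fun _ => ⟨by simp only [Cands.dig, h1, add_zero], fun h => hd ?_⟩⟩
    exact (pow_dvd_pow b (Nat.le_succ i)).trans h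

/-- Rows of length `d` do not overlap. -/
theorem row_lt {d t t' i : ℕ} (h : t' < t) (hi : i < d) : t' * d + i < t * d := by
  have : (t' + 1) * d ≤ t * d := Nat.mul_le_mul_right _ h
  rw [Nat.add_mul, one_mul] at this
  omega

theorem runs_fillDigits {Z : ℕ} {s : State} {N d B : ℕ} (hd : s.nat vD 0 = d)
    (hb : s.nat vB 0 = N + 1) (hB : s.nat vS 0 = B) (hdig : ∀ i, s.nat nDig i = 0)
    (hdZ : d ≤ Z) (hBZ : B ≤ Z) :
    Runs Z fillDigits s fun s' => ∀ t < B, ∀ i < d,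
      s'.nat nDig (t * d + i) = Cands.dig (N + 1) t i := by
  refine Runs.assignNat_seq ?_
  refine Runs.forTo B (by simp [hB]) hBZ rfl rfl (by decide)
    (fun t s' => s'.nat vRowT 0 = t * d ∧ ∀ t' ≤ t, ∀ i < d,
      s'.nat nDig (t' * d + i) = Cands.dig (N + 1) t' i) ?_ ?_ ?_
  · refine ⟨by simp, fun t' ht' i _ => ?_⟩
    obtain rfl : t' = 0 := by omega
    simp [hdig]
  · rintro t - s₁ ⟨hrow, hrows⟩ hvt hf
    have hd₁ : s₁.nat vD 0 = d := by rw [hf.1 vD rfl]; simpa using hd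
    have hb₁ : s₁.nat vB 0 = N + 1 := by rw [hf.1 vB rfl]; simpa using hb
    refine Runs.assignNat_seq (Runs.seq (R := fun s' => ∀ t' ≤ t + 1, ∀ i < d,
      s'.nat nDig (t' * d + i) = Cands.dig (N + 1) t' i) ?_ ?_)
    · refine Runs.forTo d (by simpa using hd₁) hdZ rfl rfl (by decide)
        (fun i s' => (∀ t' ≤ t, ∀ i < d, s'.nat nDig (t' * d + i) = Cands.dig (N + 1) t' i) ∧
          (∀ i' < i, s'.nat nDig ((t + 1) * d + i') = Cands.dig (N + 1) (t + 1) i') ∧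
          s'.nat vCarry 0 = if (N + 1) ^ i ∣ t + 1 then 1 else 0) ?_ ?_ ?_
      · simpa using hrows
      · rintro i hi s₂ ⟨h1, h2, h3⟩ hvi hf₂
        have hd₂ : s₂.nat vD 0 = d := by rw [hf₂.1 vD rfl]; simpa using hd₁
        have hb₂ : s₂.nat vB 0 = N + 1 := by rw [hf₂.1 vB rfl]; simpa using hb₁
        have hrow₂ : s₂.nat vRowT 0 = t * d := by rw [hf₂.1 vRowT rfl]; simpa using hrow
        have haddr : t * d + d + i = (t + 1) * d + i := by ring
        have hne : ∀ t' ≤ t, ∀ i' < d, t' * d + i' ≠ (t + 1) * d + i := fun t' ht' i' hi' => by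
          have := row_lt (d := d) (show t' < t + 1 by omega) hi'
          omega
        have hsucc := dig_succ (b := N + 1) (by omega) t i
        refine Runs.assignNat_seq (Runs.branch (fun ht => ?_) (fun ht => ?_))
        · have ht' : N + 1 ≤ Cands.dig (N + 1) t i + s₂.nat vCarry 0 := by
            simpa [hb₂, hrow₂, hvi, h1 t le_rfl i hi] using ht
          rw [h3] at ht'
          obtain ⟨h4, h5, h6⟩ := hsucc.1 ht'
          refine Runs.assignNat ?_
          simp only [NExpr.eval, State.setNat_nat_same, State.setNat_nat_of_ne, ne_eq,
            Nat.reduceEqDiff, not_false_eq_true, hrow₂, hd₂, hvi, haddr]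
          refine ⟨fun t' ht' i' hi' => ?_, fun i' hi' => ?_, ?_⟩
          · rw [Function.update_of_ne (hne t' ht' i' hi'), h1 t' ht' i' hi']
          · rcases Nat.lt_or_ge i' i with h | h
            · rw [Function.update_of_ne (by omega), h2 i' h]
            · obtain rfl : i' = i := by omega
              rw [Function.update_self, h4]
          · rw [h3, if_pos h5, if_pos h6]
        · have ht' : ¬ N + 1 ≤ Cands.dig (N + 1) t i + s₂.nat vCarry 0 := by
            simpa [hb₂, hrow₂, hvi, h1 t le_rfl i hi] using ht
          rw [h3] at ht'
          obtain ⟨h4, h5⟩ := hsucc.2 ht'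
          refine Runs.assignNat_seq (Runs.assignNat ?_)
          simp only [NExpr.eval, State.setNat_nat_same, State.setNat_nat_of_ne, ne_eq,
            Nat.reduceEqDiff, not_false_eq_true, hrow₂, hd₂, hvi, haddr,
            Function.update_self, h1 t le_rfl i hi, h3]
          refine ⟨fun t' ht' i' hi' => ?_, fun i' hi' => ?_, ?_⟩
          · rw [Function.update_of_ne (hne t' ht' i' hi'), h1 t' ht' i' hi']
          · rcases Nat.lt_or_ge i' i with h | h
            · rw [Function.update_of_ne (by omega), h2 i' h]
            · obtain rfl : i' = i := by omega
              rw [Function.update_self, h4]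
          · rw [if_neg h5]
      · rintro s₂ ⟨h1, h2, -⟩ - t' ht' i hi
        rcases Nat.lt_or_ge t t' with h | h
        · obtain rfl : t' = t + 1 := by omega
          exact h2 i hi
        · exact h1 t' h i hi
    · intro s₂ hs₂ hf₂
      refine Runs.assignNat ?_
      have hd₂ : s₂.nat vD 0 = d := by rw [hf₂.1 vD rfl]; simpa using hd₁
      have hrow₂ : s₂.nat vRowT 0 = t * d := by rw [hf₂.1 vRowT rfl]; simpa using hrow
      refine ⟨?_, by simpa using hs₂⟩
      simp [hd₂, hrow₂]
      ring
  · rintro s₁ ⟨-, h⟩ - t ht i hi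
    exact h t ht.le i hi

/-! ### Computing the value table -/

/-- The memory holds the `N` candidates `C` and the parameters and digits of the states with `m`
slots. -/
structure Ready (C : Cands) (m N : ℕ) (s : State) : Prop where
  m_eq : s.nat vM 0 = m
  d_eq : s.nat vD 0 = m + 2
  b_eq : s.nat vB 0 = N + 1
  S_eq : s.nat vS 0 = (N + 1) ^ (m + 2)
  N_eq : s.nat vN 0 = N
  dig_eq : ∀ t < (N + 1) ^ (m + 2), ∀ i < m + 2,
    s.nat nDig (t * (m + 2) + i) = Cands.dig (N + 1) t i
  pt_eq : s.nat nPt = C.pt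
  lx_eq : s.real rLx = C.lx
  rx_eq : s.real rRx = C.rx
  ly_eq : s.real rLy = C.ly
  wt_eq : s.real rWt = C.wt

/-- The natural arrays that `Ready` refers to. -/
def readyNat : List ℕ := [vM, vD, vB, vS, vN, nDig, nPt]

/-- The real arrays that `Ready` refers to. -/
def readyReal : List ℕ := [rLx, rRx, rLy, rWt]

theorem Ready.congr {C : Cands} {m N : ℕ} {s s' : State} (h : Ready C m N s)
    (hn : ∀ k ∈ readyNat, s'.nat k = s.nat k) (hr : ∀ k ∈ readyReal, s'.real k = s.real k) :
    Ready C m N s' where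
  m_eq := by rw [hn vM (by decide), h.m_eq]
  d_eq := by rw [hn vD (by decide), h.d_eq]
  b_eq := by rw [hn vB (by decide), h.b_eq]
  S_eq := by rw [hn vS (by decide), h.S_eq]
  N_eq := by rw [hn vN (by decide), h.N_eq]
  dig_eq := by rw [hn nDig (by decide)]; exact h.dig_eq
  pt_eq := by rw [hn nPt (by decide), h.pt_eq]
  lx_eq := by rw [hr rLx (by decide), h.lx_eq]
  rx_eq := by rw [hr rRx (by decide), h.rx_eq]
  ly_eq := by rw [hr rLy (by decide), h.ly_eq]
  wt_eq := by rw [hr rWt (by decide), h.wt_eq]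

theorem Ready.frame {C : Cands} {m N : ℕ} {s s' : State} {p : Program} (h : Ready C m N s)
    (hf : Frame p s s') (hn : ∀ k ∈ readyNat, p.writesNat k = false)
    (hr : ∀ k ∈ readyReal, p.writesReal k = false) : Ready C m N s' :=
  h.congr (fun k hk => hf.1 k (hn k hk)) (fun k hk => hf.2 k (hr k hk))

theorem Ready.setNat {C : Cands} {m N : ℕ} {s : State} (h : Ready C m N s) {k : ℕ} (i v : ℕ)
    (hk : k ∉ readyNat) : Ready C m N (s.setNat k i v) :=
  h.congr (fun _ hk' => State.setNat_nat_of_ne _ _ _ _ (fun he => hk (he ▸ hk')))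
    (fun _ _ => rfl)

theorem Ready.setReal {C : Cands} {m N : ℕ} {s : State} (h : Ready C m N s) {k : ℕ} (i : ℕ) (v : ℝ)
    (hk : k ∉ readyReal) : Ready C m N (s.setReal k i v) :=
  h.congr (fun _ _ => rfl)
    (fun _ hk' => State.setReal_real_of_ne _ _ _ _ (fun he => hk (he ▸ hk')))

/-- The test `a = b` for natural expressions. -/
def natEq (a b : NExpr) : Test := .and (.natLe a b) (.natLe b a)

/-- The test for `t` or `u`. -/
def orTest (t u : Test) : Test := .neg (.and (.neg t) (.neg u))

@[simp] theorem natEq_holds (s : State) (a b : NExpr) :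
    (natEq a b).holds s ↔ a.eval s = b.eval s := by
  simp only [natEq, Test.holds]
  exact ⟨fun h => le_antisymm h.1 h.2, fun h => ⟨h.le, h.ge⟩⟩

@[simp] theorem orTest_holds (s : State) (t u : Test) :
    (orTest t u).holds s ↔ t.holds s ∨ u.holds s := by
  simp only [orTest, Test.holds]
  tauto

/-- The test for `Cands.SlotOK`. -/
def slotTest (f r g : NExpr) : Test :=
  orTest (natEq f (.lit 0)) (.and (.realLe (.read rLx f) (.read rLx r)) (.and
    (.and (.neg (natEq (.read nPt f) (.read nPt r)))
      (orTest (.realLe (.read rRx f) (.read rLx r))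
        (orTest (.realLe (.read rRx r) (.read rLx f))
          (orTest (.realLe (.add (.read rLy f) (.lit 1)) (.read rLy r))
            (.realLe (.add (.read rLy r) (.lit 1)) (.read rLy f))))))
    (orTest (natEq g f) (.neg (.realLe (.read rLx r) (.read rRx f))))))

theorem slotTest_holds {C : Cands} {m N : ℕ} {s : State} (h : Ready C m N s) (f r g : NExpr) :
    (slotTest f r g).holds s ↔ C.SlotOK (f.eval s) (r.eval s) (g.eval s) := by
  simp [slotTest, Cands.SlotOK, Cands.Indep, h.pt_eq, h.lx_eq, h.rx_eq, h.ly_eq]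

/-- The test for the conditions of `Cands.Switch` on the floors and ceilings of two states. -/
def switchTest (f1 g0 g1 : NExpr) : Test :=
  .and (natEq g0 f1) (orTest (natEq f1 (.lit 0))
    (.and (.neg (natEq g1 (.lit 0))) (.realLe (.read rLy f1) (.read rLy g1))))

/-- The test for the conditions of `Cands.Add` on the floors and ceilings of two states. -/
def addTest (f0 f1 r g0 g1 : NExpr) : Test :=
  .and (.neg (natEq r (.lit 0))) (.and
    (orTest (natEq f0 (.lit 0))
      (.neg (.realLe (.read rLy r) (.add (.read rLy f0) (.lit 1))))) (.and
    (.neg (natEq f1 (.lit 0))) (.and (.realLe (.read rLy r) (.read rLy f1)) (.and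
    (natEq g0 f0) (natEq g1 f1)))))

/-- The digit with index `i` of the state whose row starts at the value of the variable `k`. -/
abbrev digitAt (k : ℕ) (i : NExpr) : NExpr := .read nDig (.add (.var k) i)

/-- The program that sets `vEdge` to a nonzero value if the label `vR` leads from the state with
the row `vRowT` to the state with the row `vRowU`. -/
def checkStep : Program :=
  .assignNat vClear (.lit 0) (.lit 1) ;;
  .assignNat vOk (.lit 0) (.lit 1) ;;
  .assignNat vFound (.lit 0) (.lit 0) ;;
  .forTo vK vM (
    .assignNat vF (.lit 0) (digitAt vRowT (.add (.var vK) (.lit 2))) ;;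
    .assignNat vG (.lit 0) (digitAt vRowU (.add (.var vK) (.lit 2))) ;;
    .branch (natEq (.var vG) (.lit 0)) .nop (.assignNat vClear (.lit 0) (.lit 0)) ;;
    .branch (slotTest (.var vF) (.var vR) (.var vG)) .nop (.assignNat vOk (.lit 0) (.lit 0)) ;;
    .branch (natEq (.var vG) (.var vR)) (.assignNat vFound (.lit 0) (.lit 1)) .nop) ;;
  .assignNat vEdge (.lit 0) (.lit 0) ;;
  .branch (.and (natEq (.var vR) (.lit 0)) (.and
      (switchTest (digitAt vRowT (.lit 1)) (digitAt vRowU (.lit 0)) (digitAt vRowU (.lit 1)))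
      (.neg (natEq (.var vClear) (.lit 0)))))
    (.assignNat vEdge (.lit 0) (.lit 1)) .nop ;;
  .branch (.and (addTest (digitAt vRowT (.lit 0)) (digitAt vRowT (.lit 1)) (.var vR)
      (digitAt vRowU (.lit 0)) (digitAt vRowU (.lit 1))) (.and
      (.neg (natEq (.var vOk) (.lit 0))) (.neg (natEq (.var vFound) (.lit 0)))))
    (.assignNat vEdge (.lit 0) (.lit 1)) .nop

theorem runs_checkStep {Z : ℕ} {C : Cands} {m N : ℕ} {s : State} (h : Ready C m N s) (hm : m ≤ Z)
    {f g : ℕ → ℕ} {r : ℕ} (hf : ∀ i < m + 2, s.nat nDig (s.nat vRowT 0 + i) = f i)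
    (hg : ∀ i < m + 2, s.nat nDig (s.nat vRowU 0 + i) = g i) (hr : s.nat vR 0 = r) :
    Runs Z checkStep s fun s' => s'.nat vEdge 0 ≠ 0 ↔ C.Step m f r g := by
  refine Runs.assignNat_seq (Runs.assignNat_seq (Runs.assignNat_seq ?_))
  refine Runs.seq (R := fun s' => (s'.nat vClear 0 ≠ 0 ↔ ∀ i < m, g (i + 2) = 0) ∧
    (s'.nat vOk 0 ≠ 0 ↔ ∀ i < m, C.SlotOK (f (i + 2)) r (g (i + 2))) ∧
    (s'.nat vFound 0 ≠ 0 ↔ ∃ i < m, g (i + 2) = r)) ?_ ?_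
  · refine Runs.forTo m (by simp [h.m_eq]) hm rfl rfl (by decide)
      (fun k s' => (s'.nat vClear 0 ≠ 0 ↔ ∀ i < k, g (i + 2) = 0) ∧
        (s'.nat vOk 0 ≠ 0 ↔ ∀ i < k, C.SlotOK (f (i + 2)) r (g (i + 2))) ∧
        (s'.nat vFound 0 ≠ 0 ↔ ∃ i < k, g (i + 2) = r)) (by simp) ?_ (fun _ h _ => h)
    rintro k hk s₁ ⟨h1, h2, h3⟩ hvk hfr
    have hR₁ : Ready C m N s₁ := Ready.frame (((h.setNat (k := vClear) 0 _ (by decide)).setNat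
      (k := vOk) 0 _ (by decide)).setNat (k := vFound) 0 _ (by decide)) hfr (by decide) (by decide)
    have hf₁ : s₁.nat nDig (s₁.nat vRowT 0 + (k + 2)) = f (k + 2) := by
      rw [hfr.1 nDig rfl, hfr.1 vRowT rfl]; simpa using hf (k + 2) (by omega)
    have hg₁ : s₁.nat nDig (s₁.nat vRowU 0 + (k + 2)) = g (k + 2) := by
      rw [hfr.1 nDig rfl, hfr.1 vRowU rfl]; simpa using hg (k + 2) (by omega)
    have hr₁ : s₁.nat vR 0 = r := by rw [hfr.1 vR rfl]; simpa using hr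
    have hall : ∀ P : ℕ → Prop, (∀ i < k + 1, P i) ↔ (∀ i < k, P i) ∧ P k := fun P =>
      Nat.forall_lt_succ_right
    have hex : ∀ P : ℕ → Prop, (∃ i < k + 1, P i) ↔ (∃ i < k, P i) ∨ P k := fun P =>
      Nat.exists_lt_succ_right
    refine Runs.assignNat_seq (Runs.assignNat_seq ?_)
    generalize hs₂ : State.setNat _ vG _ _ = s₂
    have hR₂ : Ready C m N s₂ := by
      rw [← hs₂]
      exact (hR₁.setNat _ _ (by decide)).setNat _ _ (by decide)
    have hF : s₂.nat vF 0 = f (k + 2) := by simp [← hs₂, hvk, hf₁]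
    have hG : s₂.nat vG 0 = g (k + 2) := by simp [← hs₂, hvk, hg₁]
    have hr₂ : s₂.nat vR 0 = r := by simp [← hs₂, hr₁]
    have h1 : s₂.nat vClear 0 ≠ 0 ↔ ∀ i < k, g (i + 2) = 0 := by simpa [← hs₂] using h1
    have h2 : s₂.nat vOk 0 ≠ 0 ↔ ∀ i < k, C.SlotOK (f (i + 2)) r (g (i + 2)) := by
      simpa [← hs₂] using h2
    have h3 : s₂.nat vFound 0 ≠ 0 ↔ ∃ i < k, g (i + 2) = r := by simpa [← hs₂] using h3
    clear hs₂
    refine Runs.seq (R := fun s' => s'.nat vClear 0 ≠ 0 ↔ ∀ i < k + 1, g (i + 2) = 0) ?_ ?_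
    · refine Runs.branch (fun ht => Runs.nop ?_) (fun ht => Runs.assignNat ?_)
      · rw [hall, h1]
        simp [hG] at ht
        simp [ht]
      · rw [hall]
        simp [hG] at ht
        simp [ht]
    intro s₃ h1' hf₃
    refine Runs.seq (R := fun s' => s'.nat vOk 0 ≠ 0 ↔
      ∀ i < k + 1, C.SlotOK (f (i + 2)) r (g (i + 2))) ?_ ?_
    · have hR₃ := hR₂.frame hf₃ (by decide) (by decide)
      have ht : (slotTest (.var vF) (.var vR) (.var vG)).holds s₃ ↔
          C.SlotOK (f (k + 2)) r (g (k + 2)) := by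
        rw [slotTest_holds hR₃]
        simp [hf₃.1 vF rfl, hf₃.1 vG rfl, hf₃.1 vR rfl, hF, hG, hr₂]
      rw [← hf₃.1 vOk rfl] at h2
      refine Runs.branch (fun h => Runs.nop ?_) (fun h => Runs.assignNat ?_)
      · rw [hall, h2]
        simp [ht.1 h]
      · rw [hall]
        rw [ht] at h
        simp [h]
    intro s₄ h2' hf₄
    have hG₄ : s₄.nat vG 0 = g (k + 2) := by rw [hf₄.1 vG rfl, hf₃.1 vG rfl, hG]
    have hr₄ : s₄.nat vR 0 = r := by rw [hf₄.1 vR rfl, hf₃.1 vR rfl, hr₂]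
    rw [← hf₄.1 vClear rfl] at h1'
    rw [← hf₃.1 vFound rfl, ← hf₄.1 vFound rfl] at h3
    refine Runs.branch (fun h => Runs.assignNat ?_) (fun h => Runs.nop ?_)
    · simp only [natEq_holds, NExpr.eval, hG₄, hr₄] at h
      refine ⟨by simpa using h1', by simpa using h2', ?_⟩
      rw [hex]
      simp [h]
    · simp only [natEq_holds, NExpr.eval, hG₄, hr₄] at h
      refine ⟨by simpa using h1', by simpa using h2', ?_⟩
      rw [hex, ← h3]
      simp [h]
  · rintro s₁ ⟨h1, h2, h3⟩ hfr
    have hR₁ : Ready C m N s₁ := Ready.frame (((h.setNat (k := vClear) 0 _ (by decide)).setNat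
      (k := vOk) 0 _ (by decide)).setNat (k := vFound) 0 _ (by decide)) hfr (by decide) (by decide)
    have hf₁ : ∀ i < m + 2, s₁.nat nDig (s₁.nat vRowT 0 + i) = f i := by
      rw [hfr.1 nDig rfl, hfr.1 vRowT rfl]; simpa using hf
    have hg₁ : ∀ i < m + 2, s₁.nat nDig (s₁.nat vRowU 0 + i) = g i := by
      rw [hfr.1 nDig rfl, hfr.1 vRowU rfl]; simpa using hg
    have hr₁ : s₁.nat vR 0 = r := by rw [hfr.1 vR rfl]; simpa using hr
    have hf0 := hf₁ 0 (by omega)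
    have hf1 := hf₁ 1 (by omega)
    have hg0 := hg₁ 0 (by omega)
    have hg1 := hg₁ 1 (by omega)
    rw [add_zero] at hf0 hg0
    rw [Cands.Step, Cands.Switch, Cands.Add, ← h1, ← h2, ← h3]
    refine Runs.assignNat_seq (Runs.seq (R := fun s' => s'.nat vEdge 0 ≠ 0 ↔ (r = 0 ∧ g 0 = f 1 ∧
      (f 1 = 0 ∨ (g 1 ≠ 0 ∧ C.ly (f 1) ≤ C.ly (g 1))) ∧ s₁.nat vClear 0 ≠ 0)) ?_ ?_)
    · refine Runs.branch (fun h => Runs.assignNat ?_) (fun h => Runs.nop ?_)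
      · simp [switchTest, hr₁, hf1, hg0, hg1, hR₁.ly_eq] at h
        simp [h]
      · simp [switchTest, hr₁, hf1, hg0, hg1, hR₁.ly_eq] at h
        simpa using h
    · intro s₂ h4 hf₂
      rw [← h4]
      refine Runs.branch (fun h => Runs.assignNat ?_) (fun h => Runs.nop ?_)
      · simp [addTest, hf₂.1 vR rfl, hf₂.1 nDig rfl, hf₂.1 vRowT rfl, hf₂.1 vRowU rfl,
          hf₂.1 vOk rfl, hf₂.1 vFound rfl, hf₂.2 rLy rfl, hr₁, hf0, hf1, hg0, hg1, hR₁.ly_eq] at h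
        simp [h]
      · simp [addTest, hf₂.1 vR rfl, hf₂.1 nDig rfl, hf₂.1 vRowT rfl, hf₂.1 vRowU rfl,
          hf₂.1 vOk rfl, hf₂.1 vFound rfl, hf₂.2 rLy rfl, hr₁, hf0, hf1, hg0, hg1, hR₁.ly_eq] at h
        constructor
        · exact Or.inl
        · rintro (h5 | ⟨⟨h5, h6, h7, h8, h9, h10⟩, h11, h12⟩)
          · exact h5
          · exact absurd (h h5 h6 h7 h8 h9 h10 h11) h12

/-- The program that compares the table entry of the state `vT` with the walks that start with the
step from `vT` to `vU` with the label `vR`. -/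
def relax : Program :=
  checkStep ;;
  .branch (.and (.neg (natEq (.var vEdge) (.lit 0)))
      (.realLe (.read rVal (.add (.var vHi) (.var vT)))
        (.add (.read rWt (.var vR)) (.read rVal (.add (.var vLo) (.var vU))))))
    (.assignReal rVal (.add (.var vHi) (.var vT))
        (.add (.read rWt (.var vR)) (.read rVal (.add (.var vLo) (.var vU)))) ;;
      .assignNat nLab (.add (.var vHi) (.var vT)) (.var vR) ;;
      .assignNat nSucc (.add (.var vHi) (.var vT)) (.var vU)) .nop

/-- The program that computes the table entry of the state `vT`. -/
def processState : Program :=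
  .assignReal rVal (.add (.var vHi) (.var vT)) (.read rVal (.add (.var vLo) (.var vT))) ;;
  .assignNat nLab (.add (.var vHi) (.var vT)) (.lit 0) ;;
  .assignNat nSucc (.add (.var vHi) (.var vT)) (.var vT) ;;
  .forTo vR vB (
    .assignNat vRowU (.lit 0) (.lit 0) ;;
    .forTo vU vS (
      relax ;;
      .assignNat vRowU (.lit 0) (.add (.var vRowU) (.var vD)))) ;;
  .assignNat vRowT (.lit 0) (.add (.var vRowT) (.var vD))

/-- The program that computes the value table.  The entries for walks of `l` steps are stored from
index `l * vS` on; there are `2 * vN` levels, as a set of `k` labels has at most `k` slabs. -/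
def fillTable : Program :=
  .assignNat vL (.lit 0) (.add (.var vN) (.var vN)) ;;
  .assignNat vLo (.lit 0) (.lit 0) ;;
  .assignNat vHi (.lit 0) (.var vS) ;;
  .forTo vLev vL (
    .assignNat vRowT (.lit 0) (.lit 0) ;;
    .forTo vT vS processState ;;
    .assignNat vLo (.lit 0) (.var vHi) ;;
    .assignNat vHi (.lit 0) (.add (.var vHi) (.var vS)))

/-- The specification of the table entry at index `a` for the state `t`: it describes a first step
of a walk whose weight is the value of the entry, and this is at least the weight of the walks that
stay in `t` or start with one of the steps in `Done`.  The values of the previous level are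
`prev`. -/
structure Entry (C : Cands) (m N : ℕ) (prev : ℕ → ℝ) (t : ℕ) (s : State) (a : ℕ)
    (Done : ℕ → ℕ → Prop) : Prop where
  lab_le : s.nat nLab a ≤ N
  succ_lt : s.nat nSucc a < (N + 1) ^ (m + 2)
  step : (s.nat nLab a = 0 ∧ s.nat nSucc a = t) ∨
    C.Step m (Cands.dig (N + 1) t) (s.nat nLab a) (Cands.dig (N + 1) (s.nat nSucc a))
  val_eq : s.real rVal a = C.wt (s.nat nLab a) + prev (s.nat nSucc a)
  stay : prev t ≤ s.real rVal a
  dom : ∀ r ≤ N, ∀ u < (N + 1) ^ (m + 2), Done r u →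
    C.Step m (Cands.dig (N + 1) t) r (Cands.dig (N + 1) u) → C.wt r + prev u ≤ s.real rVal a

theorem Entry.congr {C : Cands} {m N t t' a : ℕ} {prev prev' : ℕ → ℝ} {s s' : State}
    {Done Done' : ℕ → ℕ → Prop} (h : Entry C m N prev t s a Done) (ht : t = t')
    (hlt : t < (N + 1) ^ (m + 2))
    (hp : ∀ u < (N + 1) ^ (m + 2), prev' u = prev u) (hv : s'.real rVal a = s.real rVal a)
    (hl : s'.nat nLab a = s.nat nLab a) (hs : s'.nat nSucc a = s.nat nSucc a)
    (hD : ∀ r ≤ N, ∀ u < (N + 1) ^ (m + 2), Done' r u → Done r u) :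
    Entry C m N prev' t' s' a Done' := by
  subst ht
  refine ⟨?_, ?_, ?_, ?_, ?_, ?_⟩
  · rw [hl]; exact h.lab_le
  · rw [hs]; exact h.succ_lt
  · rw [hl, hs]; exact h.step
  · rw [hv, hl, hs, hp _ h.succ_lt]; exact h.val_eq
  · rw [hv, hp t hlt]; exact h.stay
  · intro r hr u hu hD' hst
    rw [hv, hp u hu]
    exact h.dom r hr u hu (hD r hr u hu hD') hst

/-- The tables in `s` and `s'` agree at the index `x`. -/
def SameAt (s s' : State) (x : ℕ) : Prop :=
  s'.real rVal x = s.real rVal x ∧ s'.nat nLab x = s.nat nLab x ∧ s'.nat nSucc x = s.nat nSucc x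

theorem SameAt.trans {s s' s'' : State} {x : ℕ} (h : SameAt s s' x) (h' : SameAt s' s'' x) :
    SameAt s s'' x :=
  ⟨h'.1.trans h.1, h'.2.1.trans h.2.1, h'.2.2.trans h.2.2⟩

theorem runs_relax {Z : ℕ} {C : Cands} {m N : ℕ} {s : State} (hR : Ready C m N s) (hm : m ≤ Z)
    {t r u lo hi : ℕ} (ht : t < (N + 1) ^ (m + 2)) (hr : r ≤ N) (hu : u < (N + 1) ^ (m + 2))
    (hT : s.nat vT 0 = t) (hvR : s.nat vR 0 = r) (hU : s.nat vU 0 = u)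
    (hrowT : s.nat vRowT 0 = t * (m + 2)) (hrowU : s.nat vRowU 0 = u * (m + 2))
    (hlo : s.nat vLo 0 = lo) (hhi : s.nat vHi 0 = hi) {prev : ℕ → ℝ}
    (hprev : s.real rVal (lo + u) = prev u) {Done : ℕ → ℕ → Prop}
    (hE : Entry C m N prev t s (hi + t) Done) :
    Runs Z relax s fun s' =>
      Entry C m N prev t s' (hi + t) (fun r' u' => Done r' u' ∨ (r' = r ∧ u' = u)) ∧
      ∀ x, x ≠ hi + t → SameAt s s' x := by
  refine Runs.seq (runs_checkStep hR hm (f := Cands.dig (N + 1) t) (g := Cands.dig (N + 1) u)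
    (r := r) ?_ ?_ hvR) ?_
  · rw [hrowT]; exact hR.dig_eq t ht
  · rw [hrowU]; exact hR.dig_eq u hu
  intro s₁ hstep hf
  have hT₁ : s₁.nat vT 0 = t := by rw [hf.1 vT rfl, hT]
  have hU₁ : s₁.nat vU 0 = u := by rw [hf.1 vU rfl, hU]
  have hvR₁ : s₁.nat vR 0 = r := by rw [hf.1 vR rfl, hvR]
  have hlo₁ : s₁.nat vLo 0 = lo := by rw [hf.1 vLo rfl, hlo]
  have hhi₁ : s₁.nat vHi 0 = hi := by rw [hf.1 vHi rfl, hhi]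
  have hval₁ : s₁.real rVal = s.real rVal := hf.2 rVal rfl
  have hlab₁ : s₁.nat nLab = s.nat nLab := hf.1 nLab rfl
  have hsucc₁ : s₁.nat nSucc = s.nat nSucc := hf.1 nSucc rfl
  have hwt₁ : s₁.real rWt = C.wt := by rw [hf.2 rWt rfl, hR.wt_eq]
  refine Runs.branch (fun h => ?_) (fun h => ?_)
  · simp only [Test.holds, natEq_holds, NExpr.eval, RExpr.eval, hT₁, hU₁, hvR₁, hlo₁, hhi₁,
      hval₁, hwt₁, hprev] at h
    obtain ⟨h1, h2⟩ := h
    have hst := hstep.1 h1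
    refine Runs.assignReal_seq (Runs.assignNat_seq (Runs.assignNat ?_))
    generalize hs₂ : State.setNat _ nSucc _ _ = s₂
    have hv : s₂.real rVal (hi + t) = C.wt r + prev u := by
      simp [← hs₂, hT₁, hU₁, hvR₁, hlo₁, hhi₁, hval₁, hwt₁, hprev]
    have hl : s₂.nat nLab (hi + t) = r := by simp [← hs₂, hT₁, hhi₁, hvR₁]
    have hs : s₂.nat nSucc (hi + t) = u := by simp [← hs₂, hT₁, hhi₁, hU₁]
    refine ⟨⟨?_, ?_, ?_, ?_, ?_, ?_⟩, fun x hx => ?_⟩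
    · rw [hl]; exact hr
    · rw [hs]; exact hu
    · rw [hl, hs]; exact Or.inr hst
    · rw [hv, hl, hs]
    · rw [hv]; exact hE.stay.trans h2
    · rintro r' hr' u' hu' (hD | ⟨rfl, rfl⟩) hst'
      · rw [hv]; exact (hE.dom r' hr' u' hu' hD hst').trans h2
      · rw [hv]
    · simp [SameAt, ← hs₂, hT₁, hhi₁, hx, hval₁, hlab₁, hsucc₁]
  · refine Runs.nop ⟨⟨?_, ?_, ?_, ?_, ?_, ?_⟩, fun x hx => ?_⟩
    · rw [hlab₁]; exact hE.lab_le
    · rw [hsucc₁]; exact hE.succ_lt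
    · rw [hlab₁, hsucc₁]; exact hE.step
    · rw [hval₁, hlab₁, hsucc₁]; exact hE.val_eq
    · rw [hval₁]; exact hE.stay
    · rintro r' hr' u' hu' (hD | ⟨rfl, rfl⟩) hst'
      · rw [hval₁]; exact hE.dom r' hr' u' hu' hD hst'
      · simp only [Test.holds, natEq_holds, NExpr.eval, RExpr.eval, hT₁, hU₁, hvR₁, hlo₁, hhi₁,
          hval₁, hwt₁, hprev] at h
        rw [hval₁]
        exact (not_le.1 fun hle => h ⟨hstep.2 hst', hle⟩).le
    · rw [SameAt, hval₁, hlab₁, hsucc₁]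
      exact ⟨rfl, rfl, rfl⟩

theorem runs_processState {Z : ℕ} {C : Cands} {m N : ℕ} {s : State} (hR : Ready C m N s)
    (hwt : C.wt 0 = 0) (hmZ : m ≤ Z) (hNZ : N + 1 ≤ Z) (hBZ : (N + 1) ^ (m + 2) ≤ Z)
    {t lo hi : ℕ} (ht : t < (N + 1) ^ (m + 2)) (hT : s.nat vT 0 = t)
    (hrowT : s.nat vRowT 0 = t * (m + 2)) (hlo : s.nat vLo 0 = lo) (hhi : s.nat vHi 0 = hi)
    (hle : lo + (N + 1) ^ (m + 2) ≤ hi) :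
    Runs Z processState s fun s' => s'.nat vRowT 0 = (t + 1) * (m + 2) ∧
      Entry C m N (fun u => s.real rVal (lo + u)) t s' (hi + t) (fun _ _ => True) ∧
      ∀ x, x ≠ hi + t → SameAt s s' x := by
  refine Runs.assignReal_seq (Runs.assignNat_seq (Runs.assignNat_seq ?_))
  generalize hs₀ : State.setNat _ nSucc _ _ = s₀
  have hR₀ : Ready C m N s₀ := by
    rw [← hs₀]
    exact ((hR.setReal _ _ (by decide)).setNat _ _ (by decide)).setNat _ _ (by decide)
  have hT₀ : s₀.nat vT 0 = t := by simp [← hs₀, hT]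
  have hrowT₀ : s₀.nat vRowT 0 = t * (m + 2) := by simp [← hs₀, hrowT]
  have hlo₀ : s₀.nat vLo 0 = lo := by simp [← hs₀, hlo]
  have hhi₀ : s₀.nat vHi 0 = hi := by simp [← hs₀, hhi]
  have hsame₀ : ∀ x, x ≠ hi + t → SameAt s s₀ x := fun x hx => by
    simp [SameAt, ← hs₀, hT, hhi, hx]
  have hE₀ : Entry C m N (fun u => s.real rVal (lo + u)) t s₀ (hi + t) (fun r _ => r < 0) := by
    have hv : s₀.real rVal (hi + t) = s.real rVal (lo + t) := by simp [← hs₀, hT, hhi, hlo]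
    have hl : s₀.nat nLab (hi + t) = 0 := by simp [← hs₀, hT, hhi]
    have hs : s₀.nat nSucc (hi + t) = t := by simp [← hs₀, hT, hhi]
    refine ⟨?_, ?_, ?_, ?_, ?_, ?_⟩
    · rw [hl]; exact Nat.zero_le _
    · rwa [hs]
    · exact Or.inl ⟨hl, hs⟩
    · rw [hv, hl, hs, hwt, zero_add]
    · rw [hv]
    · intro r _ u _ h
      omega
  clear hs₀
  refine Runs.seq (R := fun s' =>
      Entry C m N (fun u => s.real rVal (lo + u)) t s' (hi + t) (fun _ _ => True) ∧
      ∀ x, x ≠ hi + t → SameAt s s' x) ?_ ?_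
  · refine Runs.forTo (N + 1) hR₀.b_eq hNZ rfl rfl (by decide)
      (fun r s' => Entry C m N (fun u => s.real rVal (lo + u)) t s' (hi + t) (fun r' _ => r' < r) ∧
        ∀ x, x ≠ hi + t → SameAt s s' x) ?_ ?_ ?_
    · exact ⟨hE₀.congr rfl ht (fun _ _ => rfl) rfl rfl rfl (fun _ _ _ _ h => h), hsame₀⟩
    · rintro r hr s₁ ⟨hE₁, hsame₁⟩ hvR hf₁
      have hR₁ := hR₀.frame hf₁ (by decide) (by decide)
      refine Runs.assignNat_seq ?_
      refine Runs.forTo ((N + 1) ^ (m + 2)) (by simp [hR₁.S_eq]) hBZ rfl rfl (by decide)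
        (fun u s' => s'.nat vRowU 0 = u * (m + 2) ∧
          Entry C m N (fun u => s.real rVal (lo + u)) t s' (hi + t)
            (fun r' u' => r' < r ∨ (r' = r ∧ u' < u)) ∧
          ∀ x, x ≠ hi + t → SameAt s s' x) ?_ ?_ ?_
      · refine ⟨by simp, ?_, hsame₁⟩
        exact hE₁.congr rfl ht (fun _ _ => rfl) rfl rfl rfl (fun _ _ _ _ h => by omega)
      · rintro u hu s₂ ⟨hrowU, hE₂, hsame₂⟩ hvU hf₂
        have hR₂ := (hR₁.setNat (k := vRowU) 0 0 (by decide)).frame hf₂ (by decide) (by decide)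
        refine Runs.seq (runs_relax hR₂ hmZ ht (r := r) (by omega) hu
          (by rw [hf₂.1 vT rfl, State.setNat_nat_of_ne _ _ _ _ (by decide), hf₁.1 vT rfl, hT₀])
          (by rw [hf₂.1 vR rfl, State.setNat_nat_of_ne _ _ _ _ (by decide), hvR]) hvU
          (by rw [hf₂.1 vRowT rfl, State.setNat_nat_of_ne _ _ _ _ (by decide), hf₁.1 vRowT rfl,
            hrowT₀]) hrowU
          (by rw [hf₂.1 vLo rfl, State.setNat_nat_of_ne _ _ _ _ (by decide), hf₁.1 vLo rfl, hlo₀])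
          (by rw [hf₂.1 vHi rfl, State.setNat_nat_of_ne _ _ _ _ (by decide), hf₁.1 vHi rfl, hhi₀])
          (hsame₂ (lo + u) (by omega)).1 hE₂) ?_
        rintro s₃ ⟨hE₃, hsame₃⟩ hf₃
        have hrowU₃ : s₃.nat vRowU 0 = u * (m + 2) := by rw [hf₃.1 vRowU rfl, hrowU]
        have hD₃ : s₃.nat vD 0 = m + 2 := by rw [hf₃.1 vD rfl, hR₂.d_eq]
        refine Runs.assignNat ⟨?_, ?_, fun x hx => (hsame₂ x hx).trans (hsame₃ x hx)⟩
        · simp [hrowU₃, hD₃]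
          ring
        · exact hE₃.congr rfl ht (fun _ _ => rfl) rfl rfl rfl (fun _ _ _ _ h => by omega)
      · rintro s₂ ⟨-, hE₂, hsame₂⟩ -
        refine ⟨?_, hsame₂⟩
        exact hE₂.congr rfl ht (fun _ _ => rfl) rfl rfl rfl (fun _ _ _ _ h => by omega)
    · rintro s₁ ⟨hE₁, hsame₁⟩ -
      exact ⟨hE₁.congr rfl ht (fun _ _ => rfl) rfl rfl rfl (fun _ _ _ _ h => by omega), hsame₁⟩
  · rintro s₁ ⟨hE₁, hsame₁⟩ hf₁
    have hD₁ : s₁.nat vD 0 = m + 2 := by rw [hf₁.1 vD rfl, hR₀.d_eq]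
    have hrowT₁ : s₁.nat vRowT 0 = t * (m + 2) := by rw [hf₁.1 vRowT rfl, hrowT₀]
    refine Runs.assignNat ⟨?_, ?_, hsame₁⟩
    · simp [hrowT₁, hD₁]
      ring
    · exact hE₁.congr rfl ht (fun _ _ => rfl) rfl rfl rfl (fun _ _ _ _ h => h)

/-- The specification of the value table: the entries for all states and up to `L` steps. -/
structure Table (C : Cands) (m N L : ℕ) (s : State) : Prop where
  zero : ∀ t < (N + 1) ^ (m + 2), s.real rVal t = 0
  entry : ∀ l < L, ∀ t < (N + 1) ^ (m + 2),
    Entry C m N (fun u => s.real rVal (l * (N + 1) ^ (m + 2) + u)) t s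
      ((l + 1) * (N + 1) ^ (m + 2) + t) (fun _ _ => True)

theorem Table.congr {C : Cands} {m N L : ℕ} {s s' : State} (h : Table C m N L s)
    (hs : ∀ x < (L + 1) * (N + 1) ^ (m + 2), SameAt s s' x) : Table C m N L s' where
  zero t ht := by
    rw [(hs t (ht.trans_le (Nat.le_mul_of_pos_left _ (by omega)))).1, h.zero t ht]
  entry l hl t ht := by
    obtain ⟨h1, h2, h3⟩ := hs _ (row_lt (show l + 1 < L + 1 by omega) ht)
    exact (h.entry l hl t ht).congr rfl ht
      (fun u hu => (hs _ (row_lt (show l < L + 1 by omega) hu)).1) h1 h2 h3 (fun _ _ _ _ h => h)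

theorem runs_fillTable {Z : ℕ} {C : Cands} {m N : ℕ} {s : State} (hR : Ready C m N s)
    (hwt : C.wt 0 = 0) (hmZ : m ≤ Z) (hNZ : N + 1 ≤ Z) (hBZ : (N + 1) ^ (m + 2) ≤ Z)
    (hLZ : 2 * N ≤ Z) (hzero : ∀ x, s.real rVal x = 0) :
    Runs Z fillTable s fun s' => Ready C m N s' ∧ s'.nat vL 0 = 2 * N ∧
      s'.nat vLo 0 = 2 * N * (N + 1) ^ (m + 2) ∧ Table C m N (2 * N) s' := by
  set B := (N + 1) ^ (m + 2) with hB
  refine Runs.assignNat_seq (Runs.assignNat_seq (Runs.assignNat_seq ?_))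
  generalize hs₀ : State.setNat _ vHi _ _ = s₀
  have hR₀ : Ready C m N s₀ := by
    rw [← hs₀]
    exact ((hR.setNat _ _ (by decide)).setNat _ _ (by decide)).setNat _ _ (by decide)
  have hL₀ : s₀.nat vL 0 = 2 * N := by simp [← hs₀, hR.N_eq, two_mul]
  refine Runs.forTo (2 * N) hL₀ hLZ rfl rfl (by decide)
    (fun l s' => s'.nat vLo 0 = l * B ∧ s'.nat vHi 0 = (l + 1) * B ∧ Table C m N l s') ?_ ?_ ?_
  · refine ⟨by simp [← hs₀], by simp [← hs₀, hR.S_eq, ← hB], ?_, fun l hl => by omega⟩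
    intro t _
    simp [← hs₀, hzero]
  · rintro l hl s₁ ⟨hlo, hhi, hTab⟩ - hf₁
    have hR₁ := hR₀.frame hf₁ (by decide) (by decide)
    refine Runs.assignNat_seq (Runs.seq (R := fun s' => (∀ x < (l + 1) * B, SameAt s₁ s' x) ∧
      ∀ t < B, Entry C m N (fun u => s₁.real rVal (l * B + u)) t s' ((l + 1) * B + t)
        (fun _ _ => True)) ?_ ?_)
    · refine Runs.forTo B (by simp [hR₁.S_eq, ← hB]) hBZ rfl rfl (by decide)
        (fun t s' => s'.nat vRowT 0 = t * (m + 2) ∧ (∀ x < (l + 1) * B, SameAt s₁ s' x) ∧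
          ∀ t' < t, Entry C m N (fun u => s₁.real rVal (l * B + u)) t' s' ((l + 1) * B + t')
            (fun _ _ => True)) ?_ ?_ ?_
      · exact ⟨by simp, fun x _ => ⟨rfl, rfl, rfl⟩, fun t' ht' => by omega⟩
      · rintro t ht s₂ ⟨hrow, hsame, hE⟩ hvT hf₂
        have hR₂ := (hR₁.setNat (k := vRowT) 0 0 (by decide)).frame hf₂ (by decide) (by decide)
        refine (runs_processState (lo := l * B) (hi := (l + 1) * B) hR₂ hwt hmZ hNZ hBZ ht hvT hrow
          (by rw [hf₂.1 vLo rfl, State.setNat_nat_of_ne _ _ _ _ (by decide), hlo])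
          (by rw [hf₂.1 vHi rfl, State.setNat_nat_of_ne _ _ _ _ (by decide), hhi])
          (by rw [Nat.add_mul, one_mul])).mono ?_
        rintro s₃ ⟨hrow₃, hE₃, hsame₃⟩ -
        refine ⟨by simpa using hrow₃, fun x hx => ?_, fun t' ht' => ?_⟩
        · exact (hsame x hx).trans (hsame₃ x (by omega))
        · rcases Nat.lt_or_ge t' t with h | h
          · obtain ⟨h1, h2, h3⟩ := hsame₃ ((l + 1) * B + t') (by omega)
            exact (hE t' h).congr rfl (by omega) (fun _ _ => rfl) h1 h2 h3 (fun _ _ _ _ h => h)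
          · obtain rfl : t' = t := by omega
            exact hE₃.congr rfl ht
              (fun u hu => ((hsame _ (row_lt (Nat.lt_succ_self l) hu)).1).symm)
              rfl rfl rfl (fun _ _ _ _ h => h)
      · rintro s₂ ⟨-, h⟩ -
        exact h
    · rintro s₂ ⟨hsame, hE⟩ hf₂
      have hhi₂ : s₂.nat vHi 0 = (l + 1) * B := by
        rw [hf₂.1 vHi rfl, State.setNat_nat_of_ne _ _ _ _ (by decide), hhi]
      have hS₂ : s₂.nat vS 0 = B := by
        rw [hf₂.1 vS rfl, State.setNat_nat_of_ne _ _ _ _ (by decide), hR₁.S_eq]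
      refine Runs.assignNat_seq (Runs.assignNat ⟨?_, ?_, ?_⟩)
      · simp [hhi₂]
      · simp [hhi₂, hS₂]
        ring
      · have hT₂ : Table C m N l s₂ := hTab.congr hsame
        refine ⟨fun t ht => hT₂.zero t ht, fun l' hl' t ht => ?_⟩
        rcases Nat.lt_or_ge l' l with h | h
        · exact (hT₂.entry l' h t ht).congr rfl ht (fun _ _ => rfl) rfl rfl rfl
            (fun _ _ _ _ h => h)
        · obtain rfl : l' = l := by omega
          exact (hE t ht).congr rfl ht
            (fun u hu => (hsame _ (row_lt (Nat.lt_succ_self l') hu)).1)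
            rfl rfl rfl (fun _ _ _ _ h => h)
  · rintro s₁ ⟨hlo, -, hTab⟩ hf₁
    exact ⟨hR₀.frame hf₁ (by decide) (by decide), by rw [hf₁.1 vL rfl, hL₀], hlo, hTab⟩

/-! ### Reading off a labeling -/

/-- The program that follows the best walk from the state `0` and outputs its labels. -/
def emit : Program :=
  .assignNat vT (.lit 0) (.lit 0) ;;
  .forTo vLev vL (
    .assignNat vR (.lit 0) (.read nLab (.add (.var vLo) (.var vT))) ;;
    .assignNat vU (.lit 0) (.read nSucc (.add (.var vLo) (.var vT))) ;;
    .branch (natEq (.var vR) (.lit 0)) .nop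
      (.assignNat nOut (.read nPt (.var vR)) (.lit 1) ;;
        .assignReal rOutX (.read nPt (.var vR)) (.read rLx (.var vR)) ;;
        .assignReal rOutY (.read nPt (.var vR)) (.read rLy (.var vR))) ;;
    .assignNat vT (.lit 0) (.var vU) ;;
    .assignNat vLo (.lit 0) (.sub (.var vLo) (.var vS)))

/-- The output arrays hold the set of candidates `S`. -/
structure Output (C : Cands) (S : Finset ℕ) (s : State) : Prop where
  mem_iff : ∀ i, s.nat nOut i ≠ 0 ↔ ∃ r ∈ S, C.pt r = i
  x_eq : ∀ r ∈ S, s.real rOutX (C.pt r) = C.lx r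
  y_eq : ∀ r ∈ S, s.real rOutY (C.pt r) = C.ly r

theorem Output.congr {C : Cands} {S : Finset ℕ} {s s' : State} (h : Output C S s)
    (h1 : s'.nat nOut = s.nat nOut) (h2 : s'.real rOutX = s.real rOutX)
    (h3 : s'.real rOutY = s.real rOutY) : Output C S s' :=
  ⟨by rw [h1]; exact h.mem_iff, by rw [h2]; exact h.x_eq, by rw [h3]; exact h.y_eq⟩

theorem runs_emit {Z : ℕ} {C : Cands} {m N L : ℕ} {s : State} (hR : Ready C m N s)
    (hC : C.Proper N) (hLZ : L ≤ Z) (hL : s.nat vL 0 = L)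
    (hlo : s.nat vLo 0 = L * (N + 1) ^ (m + 2)) (hTab : Table C m N L s)
    (hout : ∀ i, s.nat nOut i = 0) :
    Runs Z emit s fun s' => ∃ S : Finset ℕ, (∀ r ∈ S, 1 ≤ r ∧ r ≤ N) ∧
      (∀ r ∈ S, ∀ r' ∈ S, r ≠ r' → C.Indep r r') ∧ Output C S s' ∧
      ∑ r ∈ S, C.wt r = s.real rVal (L * (N + 1) ^ (m + 2)) := by
  set B := (N + 1) ^ (m + 2) with hB
  refine Runs.assignNat_seq ?_
  refine Runs.forTo L (by simp [hL]) hLZ rfl rfl (by decide)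
    (fun k s' => ∃ (S : Finset ℕ) (t : ℕ), s'.nat vT 0 = t ∧ t < B ∧ s'.nat vLo 0 = (L - k) * B ∧
      C.Inv m N (Cands.dig (N + 1) t) S ∧ Output C S s' ∧
      ∑ r ∈ S, C.wt r + s.real rVal ((L - k) * B + t) = s.real rVal (L * B)) ?_ ?_ ?_
  · refine ⟨∅, 0, by simp, by positivity, by simp [hlo], ?_, ?_, by simp⟩
    · constructor <;> simp
    · constructor <;> simp [hout]
  · rintro k hk s₁ ⟨S, t, hT, ht, hlo₁, hInv, hOut, hsum⟩ - hf₁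
    have hlab₁ : s₁.nat nLab = s.nat nLab := by rw [hf₁.1 nLab rfl]; rfl
    have hsucc₁ : s₁.nat nSucc = s.nat nSucc := by rw [hf₁.1 nSucc rfl]; rfl
    have hR₁ := (hR.setNat (k := vT) 0 0 (by decide)).frame hf₁ (by decide) (by decide)
    obtain ⟨l, hl⟩ : ∃ l, L - k = l + 1 := ⟨L - k - 1, by omega⟩
    have hl' : L - (k + 1) = l := by omega
    rw [hl] at hlo₁ hsum
    have hE := hTab.entry l (by omega) t ht
    rw [← hB] at hE
    obtain ⟨r, hr⟩ : ∃ r, r = s.nat nLab ((l + 1) * B + t) := ⟨_, rfl⟩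
    obtain ⟨u, hu⟩ : ∃ u, u = s.nat nSucc ((l + 1) * B + t) := ⟨_, rfl⟩
    have hrN := hE.lab_le
    have huB := hE.succ_lt
    have hstep := hE.step
    have hval := hE.val_eq
    rw [← hr] at hrN hstep hval
    rw [← hu] at huB hstep hval
    rw [hval] at hsum
    refine Runs.assignNat_seq (Runs.assignNat_seq ?_)
    generalize hs₂ : State.setNat _ vU _ _ = s₂
    have hR₂ : Ready C m N s₂ := by
      rw [← hs₂]
      exact (hR₁.setNat _ _ (by decide)).setNat _ _ (by decide)
    have hvR : s₂.nat vR 0 = r := by simp [← hs₂, hlo₁, hT, hlab₁, hr]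
    have hvU : s₂.nat vU 0 = u := by simp [← hs₂, hlo₁, hT, hsucc₁, hu]
    have hlo₂ : s₂.nat vLo 0 = (l + 1) * B := by simp [← hs₂, hlo₁]
    have hOut₂ : Output C S s₂ := by
      rw [← hs₂]
      exact hOut.congr rfl rfl rfl
    clear hs₂
    refine Runs.seq (R := fun s' => ∃ S' : Finset ℕ, C.Inv m N (Cands.dig (N + 1) u) S' ∧
      Output C S' s' ∧ ∑ r ∈ S', C.wt r = ∑ r ∈ S, C.wt r + C.wt r) ?_ ?_
    · refine Runs.branch (fun h => Runs.nop ?_) (fun h => ?_)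
      · have hr0 : r = 0 := by simpa [hvR] using h
        refine ⟨S, ?_, hOut₂, by rw [hr0, hC.wt_zero, add_zero]⟩
        rcases hstep with ⟨-, rfl⟩ | ⟨-, hsw⟩ | ⟨hadd, -⟩
        · exact hInv
        · exact hInv.switch hsw
        · exact absurd hr0 hadd.1
      · have hr0 : r ≠ 0 := by simpa [hvR] using h
        have hadd : C.Add m (Cands.dig (N + 1) t) r (Cands.dig (N + 1) u) := by
          rcases hstep with ⟨h0, -⟩ | ⟨h0, -⟩ | hadd
          · exact absurd h0 hr0
          · exact absurd h0 hr0
          · exact hadd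
        obtain ⟨hrS, hInv'⟩ := hInv.add hC hadd hrN
        have hpt : ∀ r' ∈ S, C.pt r' ≠ C.pt r := fun r' hr' =>
          (hInv.indep_of_add hC hadd hrN hr').1
        refine Runs.assignNat_seq (Runs.assignReal_seq (Runs.assignReal ?_))
        refine ⟨insert r S, hInv', ⟨fun i => ?_, fun r' hr' => ?_, fun r' hr' => ?_⟩, ?_⟩
        · by_cases hi : i = C.pt r
          · simp [hR₂.pt_eq, hvR, hi]
          · have hi' : C.pt r ≠ i := fun h => hi h.symm
            simpa [hR₂.pt_eq, hvR, hi, hi'] using hOut₂.mem_iff i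
        · rcases Finset.mem_insert.1 hr' with rfl | hr'
          · simp [hR₂.pt_eq, hvR, hR₂.lx_eq]
          · simpa [hR₂.pt_eq, hvR, hpt r' hr'] using hOut₂.x_eq r' hr'
        · rcases Finset.mem_insert.1 hr' with rfl | hr'
          · simp [hR₂.pt_eq, hvR, hR₂.ly_eq]
          · simpa [hR₂.pt_eq, hvR, hpt r' hr'] using hOut₂.y_eq r' hr'
        · rw [Finset.sum_insert hrS, add_comm]
    · rintro s₃ ⟨S', hInv', hOut', hsum'⟩ hf₃
      have hlo₃ : s₃.nat vLo 0 = (l + 1) * B := by rw [hf₃.1 vLo rfl, hlo₂]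
      have hvU₃ : s₃.nat vU 0 = u := by rw [hf₃.1 vU rfl, hvU]
      have hS₃ : s₃.nat vS 0 = B := by rw [hf₃.1 vS rfl, hR₂.S_eq]
      refine Runs.assignNat_seq (Runs.assignNat ⟨S', u, ?_, huB, ?_, hInv', ?_, ?_⟩)
      · simp [hvU₃]
      · simp [hlo₃, hS₃, hl', Nat.add_mul]
      · exact hOut'.congr rfl rfl rfl
      · rw [hl', hsum', add_assoc, hsum]
  · rintro s₁ ⟨S, t, -, ht, -, hInv, hOut, hsum⟩ -
    rw [Nat.sub_self, zero_mul, zero_add, hTab.zero t ht, add_zero] at hsum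
    exact ⟨S, fun r hr => ⟨hInv.pos r hr, hInv.le r hr⟩, hInv.indep, hOut, hsum⟩

/-- The values in the table bound the weights of all walks. -/
theorem Table.dominates {C : Cands} {m N L : ℕ} {s : State} (h : Table C m N L s) :
    C.Dominates m N L fun l t => s.real rVal (l * (N + 1) ^ (m + 2) + t) where
  nonneg t ht := by simp [h.zero t ht]
  mono l hl t ht := (h.entry l hl t ht).stay
  step l hl t ht r hr u hu hst := (h.entry l hl t ht).dom r hr u hu trivial hst

/-! ### Labelings and sets of independent candidates -/

theorem disjoint_label_iff {l l' : ℝ} (hl : 0 < l) (hl' : 0 < l') (z z' : ℝ × ℝ) :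
    Disjoint (label l z) (label l' z') ↔
      z.1 + l ≤ z'.1 ∨ z'.1 + l' ≤ z.1 ∨ z.2 + 1 ≤ z'.2 ∨ z'.2 + 1 ≤ z.2 := by
  have key : ∀ {a b c d : ℝ}, a < b → c < d →
      (Disjoint (Set.Ioo a b) (Set.Ioo c d) ↔ b ≤ c ∨ d ≤ a) := by
    intro a b c d hab hcd
    rw [Set.Ioo_disjoint_Ioo, min_le_iff, le_max_iff, le_max_iff]
    constructor
    · rintro ((h | h) | (h | h))
      · linarith
      · exact Or.inl h
      · exact Or.inr h
      · linarith
    · rintro (h | h)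
      · exact Or.inl (Or.inr h)
      · exact Or.inr (Or.inl h)
  rw [label, label, Set.disjoint_prod, key (by linarith) (by linarith),
    key (by linarith) (by linarith), or_assoc]

theorem mem_Icc_of_mem_frontier_label {l : ℝ} (hl : 0 < l) {a : ℝ × ℝ}
    (ha : a ∈ frontier (label l (0, 0))) : (0 ≤ a.1 ∧ a.1 ≤ l) ∧ (0 ≤ a.2 ∧ a.2 ≤ 1) := by
  have h := frontier_subset_closure ha
  rw [label, closure_prod_eq, closure_Ioo (by simpa using hl.ne), closure_Ioo (by simp), zero_add,
    zero_add] at h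
  exact h

variable {I : Instance} {C : Cands} {N : ℕ}

theorem Lists.proper (h : Lists I C N) : C.Proper N where
  lt r hr hr' := by
    obtain ⟨i, a, -, h1, h2, h3, h4, h5⟩ := h.sound r hr hr'
    have := I.length_pos i
    linarith
  wt_nonneg r hr hr' := by
    obtain ⟨i, a, -, h1, h2, h3, h4, h5⟩ := h.sound r hr hr'
    rw [h5]
    exact I.weight_nonneg i
  wt_zero := h.wt_zero
  touch := by
    refine ⟨fun i => if hi : i < I.n then I.point ⟨i, hi⟩ else 0, fun r hr hr' => ?_⟩
    obtain ⟨i, a, ha, h1, h2, h3, h4, h5⟩ := h.sound r hr hr'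
    obtain ⟨⟨h6, h7⟩, h8, h9⟩ :=
      mem_Icc_of_mem_frontier_label (I.length_pos i) (I.anchors_mem i a ha)
    simp only [h1, i.2, dite_true, Fin.eta]
    refine ⟨⟨?_, ?_⟩, ?_, ?_⟩ <;> linarith

theorem Lists.isLabeling (h : Lists I C N) {S : Finset ℕ} (hS : ∀ r ∈ S, 1 ≤ r ∧ r ≤ N)
    (hind : ∀ r ∈ S, ∀ r' ∈ S, r ≠ r' → C.Indep r r') {s : State} (hout : Output C S s) :
    I.IsLabeling (I.outputSet s) (I.outputPos s) ∧
      I.weightOf (I.outputSet s) = ∑ r ∈ S, C.wt r := by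
  have hmem : ∀ i, i ∈ I.outputSet s ↔ ∃ r ∈ S, C.pt r = i := fun i => by
    simp [Instance.outputSet, hout.mem_iff]
  have hdata : ∀ i : Fin I.n, ∀ r ∈ S, C.pt r = i → I.outputPos s i = (C.lx r, C.ly r) ∧
      ∃ a ∈ I.anchors i, IsCand I C r i a := by
    intro i r hr hri
    obtain ⟨i', a, ha, hc⟩ := h.sound r (hS r hr).1 (hS r hr).2
    obtain rfl : i' = i := Fin.ext (by rw [← hri, hc.1])
    refine ⟨?_, a, ha, hc⟩
    rw [Instance.outputPos, ← hri, hout.x_eq r hr, hout.y_eq r hr]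
  refine ⟨⟨fun i hi => ?_, fun i hi j hj hij => ?_⟩, ?_⟩
  · obtain ⟨r, hr, hri⟩ := (hmem i).1 hi
    obtain ⟨h1, a, ha, -, h2, h3, -⟩ := hdata i r hr hri
    refine ⟨a, ha, ?_⟩
    rw [h1]
    ext <;> simp [h2, h3]
  · obtain ⟨r, hr, hri⟩ := (hmem i).1 hi
    obtain ⟨r', hr', hri'⟩ := (hmem j).1 hj
    obtain ⟨h1, a, -, -, h2, h3, h4, -⟩ := hdata i r hr hri
    obtain ⟨h1', a', -, -, h2', h3', h4', -⟩ := hdata j r' hr' hri'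
    have hne : r ≠ r' := by
      rintro rfl
      exact hij (Fin.ext (by rw [← hri, ← hri']))
    rw [disjoint_label_iff (I.length_pos i) (I.length_pos j), h1, h1']
    have := (hind r hr r' hr' hne).2
    rw [h4, h4', ← h2, ← h2'] at this
    exact this
  · symm
    refine Finset.sum_bij (fun r hr => (⟨C.pt r, ?_⟩ : Fin I.n)) ?_ ?_ ?_ ?_
    · obtain ⟨i, a, -, h1, -⟩ := h.sound r (hS r hr).1 (hS r hr).2
      rw [h1]
      exact i.2
    · intro r hr
      exact (hmem _).2 ⟨r, hr, rfl⟩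
    · intro r hr r' hr' he
      by_contra hne
      exact (hind r hr r' hr' hne).1 (Fin.ext_iff.1 he)
    · intro i hi
      obtain ⟨r, hr, hri⟩ := (hmem i).1 hi
      exact ⟨r, hr, Fin.ext hri⟩
    · intro r hr
      obtain ⟨-, a, -, -, -, -, -, h5⟩ := hdata ⟨C.pt r, _⟩ r hr rfl
      exact h5

theorem Lists.exists_cands (h : Lists I C N) {Q : Finset (Fin I.n)} {z : Fin I.n → ℝ × ℝ}
    (hQ : I.IsLabeling Q z) : ∃ S : Finset ℕ, (∀ r ∈ S, 1 ≤ r) ∧ (∀ r ∈ S, r ≤ N) ∧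
      (∀ r ∈ S, ∀ r' ∈ S, r ≠ r' → C.Indep r r') ∧ ∑ r ∈ S, C.wt r = I.weightOf Q := by
  have hex : ∀ i ∈ Q, ∃ r, 1 ≤ r ∧ r ≤ N ∧ C.pt r = i ∧ C.lx r = (z i).1 ∧ C.ly r = (z i).2 ∧
      C.rx r = (z i).1 + I.length i ∧ C.wt r = I.weight i := by
    intro i hi
    obtain ⟨a, ha, hza⟩ := hQ.1 i hi
    obtain ⟨r, hr, hr', h1, h2, h3, h4, h5⟩ := h.complete i a ha
    rw [← hza] at h2 h3 h4
    simp only [Prod.fst_add, Prod.snd_add, add_sub_cancel_right] at h2 h3 h4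
    exact ⟨r, hr, hr', h1, h2, h3, h4, h5⟩
  choose! ρ hρ using hex
  refine ⟨Q.image ρ, ?_, ?_, ?_, ?_⟩
  · simpa using fun i hi => (hρ i hi).1
  · simpa using fun i hi => (hρ i hi).2.1
  · intro r hr r' hr' hne
    obtain ⟨i, hi, rfl⟩ := Finset.mem_image.1 hr
    obtain ⟨j, hj, rfl⟩ := Finset.mem_image.1 hr'
    obtain ⟨-, -, h1, h2, h3, h4, -⟩ := hρ i hi
    obtain ⟨-, -, h1', h2', h3', h4', -⟩ := hρ j hj
    have hij : i ≠ j := fun he => hne (by rw [he])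
    refine ⟨by rw [h1, h1']; exact fun he => hij (Fin.ext he), ?_⟩
    rw [h2, h2', h3, h3', h4, h4']
    exact (disjoint_label_iff (I.length_pos i) (I.length_pos j) _ _).1 (hQ.2 i hi j hj hij)
  · rw [Finset.sum_image, Instance.weightOf]
    · exact Finset.sum_congr rfl fun i hi => (hρ i hi).2.2.2.2.2.2
    · intro i hi j hj he
      have h1 := (hρ i hi).2.2.1
      have h2 := (hρ j hj).2.2.1
      rw [he] at h1
      exact Fin.ext (h1.symm.trans h2)

/-! ### The approximation scheme -/

/-- The approximation scheme: the heaviest labeling that the dynamic program can find. -/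
def solve : Program :=
  collect ;; setParameters ;; fillDigits ;; fillTable ;; emit

theorem runs_solve {Z M : ℕ} {ε : ℝ} (I : Instance) (hM : 1 ≤ M) (hMε : 1 ≤ M * ε)
    (hmin : ∀ i : ℕ, i < M → i * ε < 1) (hI : I.size ≤ Z) (hMZ : 2 * M + 2 ≤ Z)
    (hNZ : 2 * I.allAnchors.length + 1 ≤ Z)
    (hBZ : (I.allAnchors.length + 1) ^ (2 * M + 2) ≤ Z) :
    Runs Z solve (I.input ε) fun s => I.IsApproxLabeling ε (I.outputSet s) (I.outputPos s) := by
  set N := I.allAnchors.length with hN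
  refine Runs.seq (runs_collect hI) ?_
  rintro s₁ ⟨hN₁, hC⟩ hf₁
  rw [← hN] at hN₁ hC
  refine Runs.seq (runs_setParameters (ε := ε) (by rw [hf₁.2 rEps rfl]; rfl) hM hMε hmin hN₁
    (by omega) hMZ (by omega)) ?_
  rintro s₂ ⟨hm₂, hd₂, hb₂, hS₂⟩ hf₂
  refine Runs.seq (runs_fillDigits (N := N) hd₂ hb₂ hS₂
    (by rw [hf₂.1 nDig rfl, hf₁.1 nDig rfl]; intro i; rfl) hMZ hBZ) ?_
  intro s₃ hdig hf₃
  have hR₃ : Ready (candsOf s₁) (2 * M) N s₃ := by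
    constructor
    · rw [hf₃.1 vM rfl, hm₂]
    · rw [hf₃.1 vD rfl, hd₂]
    · rw [hf₃.1 vB rfl, hb₂]
    · rw [hf₃.1 vS rfl, hS₂]
    · rw [hf₃.1 vN rfl, hf₂.1 vN rfl, hN₁]
    · exact hdig
    · rw [hf₃.1 nPt rfl, hf₂.1 nPt rfl, candsOf]
    · rw [hf₃.2 rLx rfl, hf₂.2 rLx rfl, candsOf]
    · rw [hf₃.2 rRx rfl, hf₂.2 rRx rfl, candsOf]
    · rw [hf₃.2 rLy rfl, hf₂.2 rLy rfl, candsOf]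
    · rw [hf₃.2 rWt rfl, hf₂.2 rWt rfl, candsOf]
  refine Runs.seq (runs_fillTable hR₃ hC.wt_zero (by omega) (by omega) hBZ (by omega)
    (by rw [hf₃.2 rVal rfl, hf₂.2 rVal rfl, hf₁.2 rVal rfl]; intro i; rfl)) ?_
  rintro s₄ ⟨hR₄, hL₄, hlo₄, hTab⟩ hf₄
  refine (runs_emit hR₄ hC.proper (by omega) hL₄ hlo₄ hTab
    (by rw [hf₄.1 nOut rfl, hf₃.1 nOut rfl, hf₂.1 nOut rfl, hf₁.1 nOut rfl]; intro i; rfl)).mono ?_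
  rintro s₅ ⟨S, hS, hind, hout, hsum⟩ -
  obtain ⟨hlab, hw⟩ := hC.isLabeling hS hind hout
  refine ⟨hlab, fun Q z hQ => ?_⟩
  obtain ⟨S', hpos, hle, hind', hsum'⟩ := hC.exists_cands hQ
  have hbest := hTab.dominates.one_sub_mul_le hC.proper hM rfl rfl S' hpos hle hind'
  rw [hsum', add_zero, ← hsum, ← hw] at hbest
  have hMR : (0 : ℝ) < M := by exact_mod_cast hM
  have h1 : 1 / (M : ℝ) ≤ ε := by
    rw [div_le_iff₀ hMR]
    linarith
  have h2 : 0 ≤ I.weightOf Q := Finset.sum_nonneg fun i _ => I.weight_nonneg i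
  exact (mul_le_mul_of_nonneg_right (by linarith) h2).trans hbest

/-- There is an exponent `K` such that the scheme makes at most `max 2 n ^ (K * ⌈1 / ε⌉)` steps on
instances of size `n`. -/
theorem exists_solvesWithin : ∃ K : ℕ, ∀ ε : ℝ, 0 < ε → ∀ I : Instance,
    SolvesWithin solve I ε ((max 2 I.size ^ (K * ⌈1 / ε⌉₊) : ℕ) : ℝ) := by
  obtain ⟨c, e, hce⟩ := solve.exists_timeBound_le
  refine ⟨c + 9 * e, fun ε hε I => ?_⟩
  set M := ⌈1 / ε⌉₊ with hMdef
  set X := max 2 I.size with hX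
  have hX2 : 2 ≤ X := le_max_left _ _
  have hXI : I.size ≤ X := le_max_right _ _
  have hM : 1 ≤ M := Nat.one_le_iff_ne_zero.2 (Nat.ceil_pos.2 (by positivity)).ne'
  have hMε : 1 ≤ M * ε := by
    rw [← div_le_iff₀ hε]
    exact Nat.le_ceil _
  have hmin : ∀ i : ℕ, i < M → i * ε < 1 := fun i hi => by
    rw [← lt_div_iff₀ hε]
    exact Nat.lt_ceil.1 hi
  have hNX : I.allAnchors.length ≤ X := by
    rw [allAnchors_length]
    unfold Instance.size at hXI
    omega
  have hpow : ∀ a b, a ≤ b → X ^ a ≤ X ^ b := fun a b h => Nat.pow_le_pow_right (by omega) h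
  have hXX : X + 1 ≤ X ^ 2 := by nlinarith
  obtain ⟨T, hT, s, hex, hs⟩ := runs_solve (Z := X ^ (8 * M)) I hM hMε hmin
    (hXI.trans (by simpa using hpow 1 (8 * M) (by omega)))
    (calc 2 * M + 2 ≤ 8 * M := by omega
      _ ≤ 2 ^ (8 * M) := Nat.lt_two_pow_self.le
      _ ≤ X ^ (8 * M) := Nat.pow_le_pow_left hX2 _)
    (calc 2 * I.allAnchors.length + 1 ≤ X ^ 3 := by nlinarith
      _ ≤ X ^ (8 * M) := hpow _ _ (by omega))
    (calc (I.allAnchors.length + 1) ^ (2 * M + 2) ≤ (X ^ 2) ^ (2 * M + 2) :=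
          Nat.pow_le_pow_left (by omega) _
      _ = X ^ (2 * (2 * M + 2)) := by rw [pow_mul]
      _ ≤ X ^ (8 * M) := hpow _ _ (by omega))
  refine ⟨T, s, hex, ?_, hs⟩
  have hone : 1 ≤ X ^ (8 * M) := Nat.one_le_pow _ _ (by omega)
  exact_mod_cast calc
    T ≤ c * (X ^ (8 * M) + 1) ^ e := hT.trans (hce _)
    _ ≤ X ^ c * (X ^ (9 * M)) ^ e := by
        refine Nat.mul_le_mul (Nat.lt_two_pow_self.le.trans (Nat.pow_le_pow_left hX2 _))
          (Nat.pow_le_pow_left ?_ _)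
        calc X ^ (8 * M) + 1 ≤ X ^ (8 * M) * 2 := by omega
          _ ≤ X ^ (8 * M) * X := Nat.mul_le_mul_left _ hX2
          _ = X ^ (8 * M + 1) := by rw [pow_succ]
          _ ≤ X ^ (9 * M) := hpow _ _ (by omega)
    _ = X ^ (c + 9 * M * e) := by rw [← pow_mul, ← pow_add]
    _ ≤ X ^ ((c + 9 * e) * M) := hpow _ _ (by nlinarith)

end Labeling4M

theorem mainTheorem6 :
    ∃ prog : RealRAM.Program, Labeling4M.IsPTAS prog ∧
      ∃ C : ℝ, ∀ ε : ℝ, 0 < ε → ε ≤ 1 → ∀ I : Labeling4M.Instance,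
        Labeling4M.SolvesWithin prog I ε ((max 2 (I.size : ℝ)) ^ (C / ε)) := by
  obtain ⟨K, hK⟩ := Labeling4M.exists_solvesWithin
  refine ⟨Labeling4M.solve, fun ε hε => ?_, 2 * K, fun ε hε hε1 I => ?_⟩
  · refine ⟨(Polynomial.X + 2) ^ (K * ⌈1 / ε⌉₊), fun I => ?_⟩
    obtain ⟨T, s, hex, hT, hs⟩ := hK ε hε I
    refine ⟨T, s, hex, hT.trans ?_, hs⟩
    have h : max 2 I.size ≤ I.size + 2 := by omega
    simpa using (by exact_mod_cast Nat.pow_le_pow_left h _ :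
      ((max 2 I.size ^ (K * ⌈1 / ε⌉₊) : ℕ) : ℝ) ≤ (((I.size + 2) ^ (K * ⌈1 / ε⌉₊) : ℕ) : ℝ))
  · obtain ⟨T, s, hex, hT, hs⟩ := hK ε hε I
    refine ⟨T, s, hex, hT.trans ?_, hs⟩
    have hceil : (⌈1 / ε⌉₊ : ℝ) ≤ 2 / ε := by
      have h1 := Nat.ceil_lt_add_one (one_div_pos.2 hε).le
      have h2 : 1 ≤ 1 / ε := by rwa [le_div_iff₀ hε, one_mul]
      have h3 : 2 / ε = 1 / ε + 1 / ε := by ring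
      linarith
    rw [Nat.cast_pow, ← Real.rpow_natCast, Nat.cast_max, Nat.cast_ofNat]
    refine Real.rpow_le_rpow_of_exponent_le (le_max_of_le_left one_le_two) ?_
    calc ((K * ⌈1 / ε⌉₊ : ℕ) : ℝ) = K * ⌈1 / ε⌉₊ := by push_cast; rfl
      _ ≤ K * (2 / ε) := by gcongr
      _ = 2 * K / ε := by ring
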